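/- Let $f,g\in\mathbb C[z]$ with $\deg f\le 8$, $\deg g\le 12$, such that $\Delta=4f^3+27g^2$, regarded as a section of $\mathcal O(24)$ on $\bar S=\mathbb P^1$, has 24 distinct zeros. Let $\bar M\to\bar S$ be the elliptic K3 surface $y^2=x^3+f(z)x+g(z)$, let $S=\{\Delta\neq0\}\subset\mathbb P^1$, and let $M\to S$ be the restriction over $S$, whose fibres are elliptic curves $E_z$. Put $\lambda=dx/y$ and let $\Lambda_z=\{\int_\gamma\lambda:\gamma\in H_1(E_z,\mathbb Z)\}$, so that $E_z=\mathbb C/\Lambda_z$ with coordinate $\zeta=\int\lambda$, the zero section being $\zeta=0$. Locally on $S$ choose cycles $\alpha,\beta$ forming an oriented basis of $H_1(E_z,\mathbb Z)$ ($\alpha\cap\beta=1$), put $\tau=\tau_1+i\tau_2=\int_\beta\lambda/\int_\alpha\lambda$, and for one-forms $\kappa,\mu$ on the fibre put $(\kappa,\mu)=\int_\alpha\kappa\int_\beta\mu-\int_\beta\kappa\int_\alpha\mu$. Let $$W=-i\int_{E_z}\bar\lambda\wedge\lambda,\qquad \theta^z=dz,\qquad \theta^w=d\zeta-\frac{(\partial\lambda,\bar\lambda)\,\zeta-(\partial\lambda,\lambda)\,\bar\zeta}{(\lambda,\bar\lambda)}\,dz,$$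 where $\partial\lambda$ has periods $\partial_z\int_\alpha\lambda$, $\partial_z\int_\beta\lambda$, and let $$B=W\,\theta^z\wedge\theta^{\bar z},\qquad F=W^{-1}\,\theta^w\wedge\theta^{\bar w},\qquad J_t=i\,(t^{-1}B+tF)\quad(t>0).$$ These are defined on $M$ and do not depend on the choice of $\alpha,\beta$. $J_t$ is the Kähler form of the semi-flat metric; let $*_{sf}$ be its Hodge star. A semi-flat harmonic two-form is a smooth real two-form $\Xi$ on $M$ such that 1. $d\Xi=0$ and $d*_{sf}\Xi=0$; 2. $\Xi\wedge B=\Xi\wedge F=0$; 3. $\int_M\Xi\wedge*_{sf}\Xi<\infty$. A doublet harmonic one-form is a smooth real one-form $\xi$ on $S$ with values in the local system dual to $H_1(E_z,\mathbb Z)$ (that is, each local choice of $\alpha,\beta$ gives a pair $(\xi^1,\xi^2)=(\xi(\alpha),\xi(\beta))$ of one-forms, which transforms under $SL(2,\mathbb Z)$ changes of the basis, and in particular under monodromy, as $(\alpha,\beta)$ does) such that, with $$\mathcal M=\frac1{\tau_2}\begin{pmatrix}|\tau|^2&-\tau_1\\-\tau_1&1\end{pmatrix}$$ and $*$ the Hodge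 star of the Riemann surface $S$, 1. $d\xi^I=0$ and $d*\mathcal M_{IJ}\xi^J=0$ for $I=1,2$; 2. $\int_S\mathcal M_{IJ}\,\xi^I\wedge*\xi^J<\infty$. Then, for every $t>0$, integration over the cycles of the fibres, $$\Xi\longmapsto\xi=\Big(\int_\alpha\Xi,\ \int_\beta\Xi\Big),$$ is a bijection from the set of semi-flat harmonic two-forms on $M$ onto the set of doublet harmonic one-forms on $S$. -/

import Mathlib

open Polynomial Set MeasureTheory
open scoped ContDiff ComplexConjugate

noncomputable section

namespace EllipticK3

/-! ### The Weierstrass family and its period lattices -/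

/-- The coefficients of the affine Weierstrass equation `y² = x³ + f(z) x + g(z)`. -/
structure Weierstrass where
  f : ℂ[X]
  g : ℂ[X]

namespace Weierstrass

/-- The discriminant `Δ = 4 f³ + 27 g²`. -/
def disc (W : Weierstrass) : ℂ[X] := 4 * W.f ^ 3 + 27 * W.g ^ 2

/-- The same fibration over the other affine chart of `ℙ¹`, with coordinate `w = -1/z` and
`x' = x / z⁴`, `y' = y / z⁶`.  For `f, g` of degree at most `8, 12` the new coefficients are
`w⁸ f(-1/w)` and `w¹² g(-1/w)`. -/
def atInfinity (W : Weierstrass) : Weierstrass where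
  f := (W.f.reflect 8).comp (-X)
  g := (W.g.reflect 12).comp (-X)

/-- The two charts: `0` is the chart with coordinate `z`, `1` the chart with `w = -1/z`. -/
def chart (W : Weierstrass) : Fin 2 → Weierstrass := ![W, W.atInfinity]

/-- `f` and `g` are sections of `𝒪(8)` and `𝒪(12)` on `ℙ¹`, and the section `Δ` of `𝒪(24)` has
24 simple zeros (in each of the two charts `Δ` has only simple zeros).  Thus the Weierstrass
equation is that of a smooth elliptic K3 surface with exactly 24 singular fibres, all nodal. -/
structure IsGenericK3 (W : Weierstrass) : Prop where
  degree_f : W.f.natDegree ≤ 8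
  degree_g : W.g.natDegree ≤ 12
  simple_zeros : ∀ c, Squarefree (W.chart c).disc

variable (W : Weierstrass)

/-- The part of the base `S = ℙ¹ ∖ {24 points}` in the given chart. -/
def base : Set ℂ := {z | W.disc.eval z ≠ 0}

/-- `L` is the period lattice of `λ = dx/y` on the fibre `E_z`:  the map
`ζ ↦ (x, y) = (4 ℘(ζ), 4 ℘'(ζ))` uniformizes `y² = x³ + f(z) x + g(z)`, and it pulls `dx/y`
back to `dζ`.  So `E_z = ℂ / L`, with the zero section at `ζ = 0`, and `ζ = ∫ λ`. -/
def Uniformizes (z : ℂ) (L : PeriodPair) : Prop :=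
  ∀ ζ, ζ ∉ L.lattice →
    (4 * L.derivWeierstrassP ζ) ^ 2 =
      (4 * L.weierstrassP ζ) ^ 3 + W.f.eval z * (4 * L.weierstrassP ζ) + W.g.eval z

/-- The lattice `Λ_z = {∫_c λ | c ∈ H₁(E_z, ℤ)} ≅ H₁(E_z, ℤ)` of periods of `λ = dx/y`. -/
def periods (z : ℂ) : Set ℂ := {γ | ∃ L : PeriodPair, W.Uniformizes z L ∧ γ ∈ L.lattice}

/-- A choice of an `A`-cycle `α` and a `B`-cycle `β`, with `α ∩ β = 1`, of the fibres over an
open set `V ⊆ S`, varying continuously; it is recorded by the holomorphic functions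
`period 0 = ∫_α λ` and `period 1 = ∫_β λ`, which form an oriented basis of each `Λ_z`. -/
structure Frame where
  V : Set ℂ
  isOpen : IsOpen V
  subset : V ⊆ W.base
  period : Fin 2 → ℂ → ℂ
  holomorphic : ∀ I, DifferentiableOn ℂ (period I) V
  oriented : ∀ z ∈ V, 0 < (period 1 z / period 0 z).im
  isBasis : ∀ z ∈ V, ∀ γ, γ ∈ W.periods z ↔ ∃ m n : ℤ, γ = m * period 0 z + n * period 1 z

instance : Nonempty W.Frame :=
  ⟨{ V := ∅, isOpen := isOpen_empty, subset := empty_subset _, period := 0,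
     holomorphic := fun _ => differentiableOn_empty,
     oriented := fun _ h => h.elim, isBasis := fun _ h => h.elim }⟩

/-- Some frame near `z`, used to evaluate at `z` quantities that do not depend on the frame. -/
def frameAt (z : ℂ) : W.Frame := Classical.epsilon fun F => z ∈ F.V

end Weierstrass

/-! ### Forms -/

/-- Real one-forms on the base chart, at a point. -/
abbrev OneForm := ℂ [⋀^Fin 1]→L[ℝ] ℝ

/-- Real two-forms on the space `ℂ × ℂ` of pairs `(z, ζ)`, at a point. -/
abbrev TwoForm := (ℂ × ℂ) [⋀^Fin 2]→L[ℝ] ℝ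

/-- The wedge product of two one-forms. -/
def wedge₁ {E : Type*} (a b : E → ℂ) (X Y : E) : ℂ := a X * b Y - a Y * b X

/-- The wedge product of two two-forms (sum over the `(2,2)`-shuffles). -/
def wedge₂ {E R : Type*} [CommRing R] (a b : E → E → R) (X : Fin 4 → E) : R :=
  a (X 0) (X 1) * b (X 2) (X 3) - a (X 0) (X 2) * b (X 1) (X 3) + a (X 0) (X 3) * b (X 1) (X 2)
  + a (X 1) (X 2) * b (X 0) (X 3) - a (X 1) (X 3) * b (X 0) (X 2) + a (X 2) (X 3) * b (X 0) (X 1)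

/-- The coordinate frame of `ℂ × ℂ`: real and imaginary direction of `z`, then of `ζ`. -/
def coordFrame : Fin 4 → ℂ × ℂ := ![(1, 0), (Complex.I, 0), (0, 1), (0, Complex.I)]

namespace Weierstrass.Frame

variable {W : Weierstrass} (F : W.Frame)

/-! ### The semi-flat metric -/

/-- `(κ, μ) = ∫_α κ ∫_β μ - ∫_β κ ∫_α μ` for one-forms on the fibre with given periods. -/
def pairing (k m : Fin 2 → ℂ) : ℂ := k 0 * m 1 - k 1 * m 0

/-- The periods of `λ`, of `λ̄`, and of `∂λ = ∂_z λ` on the fibre over `z`. -/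
def lam (z : ℂ) (I : Fin 2) : ℂ := F.period I z
def lamBar (z : ℂ) (I : Fin 2) : ℂ := conj (F.period I z)
def dLam (z : ℂ) (I : Fin 2) : ℂ := deriv (F.period I) z

/-- `w = -i ∫ λ̄ ∧ λ`, the integral being over the fibre. -/
def weight (z : ℂ) : ℝ := (-Complex.I * pairing (F.lamBar z) (F.lam z)).re

/-- `θ^z = dz`. -/
def thetaZ (_ : ℂ × ℂ) (X : ℂ × ℂ) : ℂ := X.1

/-- `θ^w = dζ - ((∂λ, λ̄) ζ - (∂λ, λ) ζ̄) / (λ, λ̄) dz`. -/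
def thetaW (p : ℂ × ℂ) (X : ℂ × ℂ) : ℂ :=
  X.2 - (pairing (F.dLam p.1) (F.lamBar p.1) * p.2 - pairing (F.dLam p.1) (F.lam p.1) * conj p.2)
    / pairing (F.lam p.1) (F.lamBar p.1) * X.1

/-- `θ^z ∧ θ^z̄` and `θ^w ∧ θ^w̄`. -/
def thetaZZ (p : ℂ × ℂ) : ℂ × ℂ → ℂ × ℂ → ℂ := wedge₁ (thetaZ p) fun X => conj (thetaZ p X)
def thetaWW (p : ℂ × ℂ) : ℂ × ℂ → ℂ × ℂ → ℂ := wedge₁ (F.thetaW p) fun X => conj (F.thetaW p X)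

/-- `B = w θ^z ∧ θ^z̄`. -/
def formB (p X Y : ℂ × ℂ) : ℂ := F.weight p.1 * thetaZZ p X Y

/-- `F = w⁻¹ θ^w ∧ θ^w̄`. -/
def formF (p X Y : ℂ × ℂ) : ℂ := (F.weight p.1 : ℂ)⁻¹ * F.thetaWW p X Y

/-- The Kähler form `J_t = i (t⁻¹ B + t F)` of the semi-flat metric. -/
def kahler (t : ℝ) (p X Y : ℂ × ℂ) : ℂ :=
  Complex.I * ((t : ℂ)⁻¹ * F.formB p X Y + t * F.formF p X Y)

/-- The semi-flat metric `⟨X, Y⟩ = J_t(X, iY)` (the values of `J_t` are real). -/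
def metric (t : ℝ) (p X Y : ℂ × ℂ) : ℝ := (F.kahler t p X (Complex.I • Y)).re

/-- `e` is an orthonormal frame at `p` for the semi-flat metric, positively oriented for the
complex orientation. -/
def IsOrientedOrthonormal (t : ℝ) (p : ℂ × ℂ) (e : Fin 4 → ℂ × ℂ) : Prop :=
  (∀ i j, F.metric t p (e i) (e j) = if i = j then 1 else 0) ∧
  0 < (Matrix.of fun i => ![(e i).1.re, (e i).1.im, (e i).2.re, (e i).2.im]).det

/-- `η' = *η`:  `(*η)(e₀, e₁) = η(e₂, e₃)` for each oriented orthonormal frame. -/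
def IsHodgeDual (t : ℝ) (p : ℂ × ℂ) (η η' : TwoForm) : Prop :=
  ∀ e, F.IsOrientedOrthonormal t p e → η' ![e 0, e 1] = η ![e 2, e 3]

/-! ### The kinetic matrix and the fundamental parallelogram -/

/-- `τ = ∫_β λ / ∫_α λ`. -/
def tau (z : ℂ) : ℂ := F.period 1 z / F.period 0 z

/-- `ℳ = τ₂⁻¹ (|τ|², -τ₁; -τ₁, 1)`. -/
def kinetic (z : ℂ) : Matrix (Fin 2) (Fin 2) ℝ :=
  (F.tau z).im⁻¹ • !![Complex.normSq (F.tau z), -(F.tau z).re; -(F.tau z).re, 1]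

/-- A fundamental domain of the lattice `Λ_z`. -/
def cell (z : ℂ) : Set ℂ :=
  {ζ | ∃ s ∈ Ico (0 : ℝ) 1, ∃ t ∈ Ico (0 : ℝ) 1, ζ = s * F.period 0 z + t * F.period 1 z}

/-- Translation by the local section `∫_α λ` (`I = 0`) or `∫_β λ` (`I = 1`) of the lattices. -/
def translate (I : Fin 2) (p : ℂ × ℂ) : ℂ × ℂ := (p.1, p.2 + F.period I p.1)

end Weierstrass.Frame

namespace Weierstrass

variable (W : Weierstrass)

/-! ### Semi-flat harmonic two-forms on `M`

`M` is the surface glued from the quotients of `S_c × ℂ` by the period lattices, where `S_0, S_1`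
are the two charts of `S`. -/

/-- The preimage in `ℂ × ℂ` of the part of `M` in the given chart. -/
def total : Set (ℂ × ℂ) := W.base ×ˢ univ

/-- The Hodge star `*_sf` of the semi-flat metric with parameter `t` on two-forms at `p`. -/
def hodge (t : ℝ) (p : ℂ × ℂ) (η : TwoForm) : TwoForm :=
  Classical.epsilon ((W.frameAt p.1).IsHodgeDual t p η)

/-- Smooth two-forms on the part of `M` in the given chart: smooth two-forms in `(z, ζ)` invariant
under translation by periods, extended by zero outside. -/
structure IsTwoForm (Ξ : ℂ × ℂ → TwoForm) : Prop where
  smooth : ContDiffOn ℝ ∞ Ξ W.total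
  extended : ∀ p ∉ W.total, Ξ p = 0
  invariant : ∀ F : W.Frame, ∀ I, ∀ p, p.1 ∈ F.V →
    Ξ p = (Ξ (F.translate I p)).compContinuousLinearMap (fderiv ℝ (F.translate I) p)

/-- `Ξ` and `*_sf Ξ` are closed. -/
def IsHarmonicTwoForm (t : ℝ) (Ξ : ℂ × ℂ → TwoForm) : Prop :=
  (∀ p ∈ W.total, extDeriv Ξ p = 0) ∧
  (∀ p ∈ W.total, extDeriv (fun q => W.hodge t q (Ξ q)) p = 0)

/-- `Ξ ∧ B = Ξ ∧ F = 0`. -/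
def IsTransverse (Ξ : ℂ × ℂ → TwoForm) : Prop :=
  ∀ p ∈ W.total, ∀ X : Fin 4 → ℂ × ℂ,
    wedge₂ (fun Y Z => ((Ξ p ![Y, Z] : ℝ) : ℂ)) ((W.frameAt p.1).formB p) X = 0 ∧
    wedge₂ (fun Y Z => ((Ξ p ![Y, Z] : ℝ) : ℂ)) ((W.frameAt p.1).formF p) X = 0

/-- The density of `Ξ ∧ *_sf Ξ` with respect to Lebesgue measure in `(z, ζ)`. -/
def normDensity (t : ℝ) (Ξ : ℂ × ℂ → TwoForm) (p : ℂ × ℂ) : ℝ :=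
  wedge₂ (fun Y Z => Ξ p ![Y, Z]) (fun Y Z => W.hodge t p (Ξ p) ![Y, Z]) coordFrame

/-- `∫ Ξ ∧ *_sf Ξ < ∞` over the part of `M` in the given chart. -/
def IsNormalizableTwoForm (t : ℝ) (Ξ : ℂ × ℂ → TwoForm) : Prop :=
  ∫⁻ z in W.base, ∫⁻ ζ in (W.frameAt z).cell z, ENNReal.ofReal (W.normDensity t Ξ (z, ζ)) < ⊤

/-- The coordinate change `(z, ζ) ↦ (-1/z, z² ζ)` from chart `0` to chart `1` of `M`. -/
def glue (p : ℂ × ℂ) : ℂ × ℂ := (-p.1⁻¹, p.1 ^ 2 * p.2)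

/-- The semi-flat harmonic two-forms on `M`; `Ξ 0` and `Ξ 1` are the expressions in the two
charts.  Chart `0` misses only the fibre over `z = ∞`, a null set. -/
structure IsSemiFlatHarmonic (t : ℝ) (Ξ : Fin 2 → ℂ × ℂ → TwoForm) : Prop where
  isTwoForm : ∀ c, (W.chart c).IsTwoForm (Ξ c)
  glued : ∀ p : ℂ × ℂ, p.1 ≠ 0 →
    Ξ 0 p = (Ξ 1 (glue p)).compContinuousLinearMap (fderiv ℝ glue p)
  harmonic : ∀ c, (W.chart c).IsHarmonicTwoForm t (Ξ c)
  transverse : ∀ c, (W.chart c).IsTransverse (Ξ c)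
  normalizable : W.IsNormalizableTwoForm t (Ξ 0)

/-! ### Doublet harmonic one-forms on `S` -/

/-- The Hodge star on one-forms of a Riemann surface, `*dx = dy` and `*dy = -dx`; it is the one of
every conformal metric. -/
def star (η : OneForm) : OneForm :=
  -η.compContinuousLinearMap (ContinuousLinearMap.mul ℝ ℂ Complex.I)

/-- `SL(2, ℤ)` doublets of smooth one-forms on the chart of `S`: smooth one-forms with
coefficients in the local system dual to `H₁(E_z, ℤ) = Λ_z`, so that `ξ z γ` is the component along
the cycle `γ` (extended by zero outside).  In a frame the doublet is `ξ^I = ξ z (F.period I z)`;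
under change of the frame, and hence under monodromy, it transforms as the cycles `(α, β)` do. -/
structure IsDoublet (ξ : ℂ → ℂ → OneForm) : Prop where
  additive : ∀ z ∈ W.base, ∀ γ ∈ W.periods z, ∀ γ' ∈ W.periods z,
    ξ z (γ + γ') = ξ z γ + ξ z γ'
  smooth : ∀ F : W.Frame, ∀ I, ContDiffOn ℝ ∞ (fun z => ξ z (F.period I z)) F.V
  extended : ∀ z γ, z ∉ W.base ∨ γ ∉ W.periods z → ξ z γ = 0

/-- `dξ^I = 0` and `d * ℳ_{IJ} ξ^J = 0` in each frame. -/
def IsHarmonicDoublet (ξ : ℂ → ℂ → OneForm) : Prop :=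
  ∀ F : W.Frame, ∀ I, ∀ z ∈ F.V,
    extDeriv (fun y => ξ y (F.period I y)) z = 0 ∧
    extDeriv (fun y => star (∑ J, F.kinetic y I J • ξ y (F.period J y))) z = 0

/-- The density of `ℳ_{IJ} ξ^I ∧ *ξ^J` with respect to Lebesgue measure in `z`. -/
def doubletDensity (ξ : ℂ → ℂ → OneForm) (z : ℂ) : ℝ :=
  let F := W.frameAt z
  ∑ I, ∑ J, F.kinetic z I J *
    (ξ z (F.period I z) ![1] * star (ξ z (F.period J z)) ![Complex.I]
      - ξ z (F.period I z) ![Complex.I] * star (ξ z (F.period J z)) ![1])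

/-- `∫ ℳ_{IJ} ξ^I ∧ *ξ^J < ∞`. -/
def IsNormalizableDoublet (ξ : ℂ → ℂ → OneForm) : Prop :=
  ∫⁻ z in W.base, ENNReal.ofReal (W.doubletDensity ξ z) < ⊤

/-- The doublet harmonic one-forms on `S`; `ξ 0` and `ξ 1` are the expressions in the two charts.
The cycle with `λ`-period `γ` in chart `0` has `λ`-period `z² γ` in chart `1`. -/
structure IsDoubletHarmonic (ξ : Fin 2 → ℂ → ℂ → OneForm) : Prop where
  isDoublet : ∀ c, (W.chart c).IsDoublet (ξ c)
  glued : ∀ z γ : ℂ, z ≠ 0 →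
    ξ 0 z γ = (ξ 1 (-z⁻¹) (z ^ 2 * γ)).compContinuousLinearMap (fderiv ℝ (fun y : ℂ => -y⁻¹) z)
  harmonic : ∀ c, (W.chart c).IsHarmonicDoublet (ξ c)
  normalizable : W.IsNormalizableDoublet (ξ 0)

/-! ### Integration over the cycles of the fibre -/

open Classical in
/-- `ξ_z(v) = ∫_γ Ξ(·, v)`: the integral of `Ξ` over the cycle `s ↦ s γ` (`0 ≤ s ≤ 1`) of
`E_z = ℂ / Λ_z`; the tangent vector of the cycle is inserted first, then the lift `(v, 0)` of a
tangent vector `v` of the base. For the cycles `α, β` of a frame these are `∫_α Ξ` and `∫_β Ξ`. -/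
def cycleIntegral (Ξ : ℂ × ℂ → TwoForm) (z γ : ℂ) : OneForm :=
  if γ ∈ W.periods z then
    ∫ s in (0 : ℝ)..1, ((Ξ (z, s * γ)).curryLeft (0, γ)).compContinuousLinearMap
      (ContinuousLinearMap.inl ℝ ℂ ℂ)
  else 0

/-- The map `Ξ ↦ (∫_α Ξ, ∫_β Ξ)`. -/
def cycleMap (Ξ : Fin 2 → ℂ × ℂ → TwoForm) : Fin 2 → ℂ → ℂ → OneForm :=
  fun c => (W.chart c).cycleIntegral (Ξ c)

end Weierstrass

end EllipticK3

end

namespace EllipticK3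

open Filter Topology
open scoped MatrixGroups

/-! ### Lattice invariants and Eisenstein series -/

/-! The statement is local over `S`, and the main point is that harmonicity forces a transverse form
to be constant along the fibres. Write `ζ = x_0 ∫_α λ + x_1 ∫_β λ` with real flat coordinates `x_I`.
The correction term in `θ^w` is exactly the one for which `θ^w = dx_0 ∫_α λ + dx_1 ∫_β λ`
(`thetaW_eq`, `fderiv_flat`). The conditions `Ξ ∧ B = Ξ ∧ F = 0` say that `Ξ` pairs only vertical
with horizontal vectors (`isMixed_iff_transverse`), so `Ξ = ∑ dx_I ∧ a_I`, where the `a_I` are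
one-forms on the base that may still depend on the point of the fibre.

On such mixed forms the Hodge star is `Ξ ↦ -Ξ(i·, i·)`, whatever `t` is (`IsMixed.isHodgeDual`). The
parts of `dΞ = 0` and `d*Ξ = 0` with two vertical arguments are then the Cauchy-Riemann equations on
each fibre (`differentiable_fibre`). A doubly periodic entire function is constant, so the `a_I`
come from the base and equal the integrals `ξ^I` over the cycles (`contract_eq_contract_zero`,
`eq_lift_of_harmonic`).

For `Ξ = ∑ dx_I ∧ ξ^I` closedness means `dξ^I = 0`. Multiplication by `i` on the fibre, in the basis
of periods, is `ℳ` up to the symplectic matrix (`coord_I_mul`), so coclosedness means `d*ℳξ = 0`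
(`iTwist_lift`, `lift_harmonic_iff`). Integrating the norm density over a period cell gives the
density of the doublet (`normDensity_eq`). Hence `fromDoublet` inverts the integration map, and
`glued_iff` matches the two charts of the base.

All this requires holomorphic oriented bases of the period lattices near every point of `S`
(`exists_frame`). They come from three facts: the modular invariant is surjective
(`exists_E₄_cube_eq`), the differential equation of `℘` determines its lattice
(`lattice_eq_of_ode`), and an injective holomorphic function has a holomorphic local inverse
(`exists_analyticAt_solution`). -/

lemma linearIndependent_of_im_pos {μ τ : ℂ} (hμ : μ ≠ 0) (hτ : 0 < τ.im) :
    LinearIndependent ℝ ![μ * τ, μ] := by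
  rw [LinearIndependent.pair_iff]
  intro s t h
  have h1 : (s : ℂ) * τ + t = 0 := by
    have : μ * ((s : ℂ) * τ + t) = 0 := by
      simp only [Complex.real_smul] at h
      linear_combination h
    exact (mul_eq_zero.1 this).resolve_left hμ
  have hs : s = 0 := by
    have := congrArg Complex.im h1
    simp at this
    exact this.resolve_right hτ.ne'
  subst hs
  simpa using h1

/-- The lattice `μ (ℤ τ + ℤ)`. -/
noncomputable def periodPair {μ τ : ℂ} (hμ : μ ≠ 0) (hτ : 0 < τ.im) : PeriodPair :=
  ⟨μ * τ, μ, linearIndependent_of_im_pos hμ hτ⟩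

lemma mem_periodPair_lattice {μ τ : ℂ} (hμ : μ ≠ 0) (hτ : 0 < τ.im) (x : ℂ) :
    x ∈ (periodPair hμ hτ).lattice ↔ ∃ m n : ℤ, x = m * μ + n * (μ * τ) := by
  rw [PeriodPair.mem_lattice]
  constructor
  · rintro ⟨m, n, h⟩
    exact ⟨n, m, by rw [← h]; simp [periodPair]; ring⟩
  · rintro ⟨m, n, rfl⟩
    exact ⟨n, m, by simp [periodPair]; ring⟩

/-- Homogeneity extracts `μ ^ k`. The sum over all nonzero pairs is `ζ(k)` times the sum over
coprime pairs, and the normalized `E` is half of the latter. -/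
lemma G_periodPair {μ τ : ℂ} (hμ : μ ≠ 0) (hτ : 0 < τ.im) {k : ℕ} (hk : 3 ≤ k) :
    (periodPair hμ hτ).G k =
      (μ ^ k)⁻¹ * (2 * riemannZeta k * ModularForm.E hk ⟨τ, hτ⟩) := by
  have hE : ModularForm.E hk ⟨τ, hτ⟩ = (1 / 2 : ℂ) * eisensteinSeries (N := 1) 0 k ⟨τ, hτ⟩ := by
    rfl
  have h2 := tsum_eisSummand_eq_riemannZeta_mul_eisensteinSeries hk ⟨τ, hτ⟩
  rw [hE, PeriodPair.G, ← ((periodPair hμ hτ).latticeEquivProd.symm.toEquiv.tsum_eq),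
    show 2 * riemannZeta k * ((1 / 2 : ℂ) * eisensteinSeries (N := 1) 0 k ⟨τ, hτ⟩)
      = riemannZeta k * eisensteinSeries (N := 1) 0 k ⟨τ, hτ⟩ by ring, ← h2,
    ← (finTwoArrowEquiv ℤ).symm.tsum_eq, ← tsum_mul_left]
  refine tsum_congr fun x => ?_
  have := (periodPair hμ hτ).latticeEquiv_symm_apply x
  rw [LinearEquiv.coe_toEquiv, this]
  simp only [periodPair, finTwoArrowEquiv_symm_apply, EisensteinSeries.eisSummand,
    Matrix.cons_val_zero, Matrix.cons_val_one, zpow_neg, zpow_natCast]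
  rw [← mul_inv, ← mul_pow]
  congr 2
  ring

lemma riemannZeta_six : riemannZeta 6 = Real.pi ^ 6 / 945 := by
  have h := riemannZeta_two_mul_nat (k := 3) (by norm_num)
  have h5 : bernoulli' 5 = 0 := bernoulli'_eq_zero_of_odd (by decide) (by norm_num)
  have h6 : _root_.bernoulli 6 = 1 / 42 := by
    rw [bernoulli_eq_bernoulli'_of_ne_one (by norm_num), bernoulli'_def]
    have c2 : Nat.choose 6 2 = 15 := by decide
    have c4 : Nat.choose 6 4 = 15 := by decide
    norm_num [Finset.sum_range_succ, c2, c4, h5]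
  norm_num [h6, Nat.factorial] at h
  rw [h]; ring

lemma g₂_periodPair {μ τ : ℂ} (hμ : μ ≠ 0) (hτ : 0 < τ.im) :
    (periodPair hμ hτ).g₂ = (μ ^ 4)⁻¹ * (4 * Real.pi ^ 4 / 3 * ModularForm.E₄ ⟨τ, hτ⟩) := by
  rw [PeriodPair.g₂, G_periodPair hμ hτ (k := 4) (by norm_num)]
  push_cast
  rw [riemannZeta_four]
  ring

lemma g₃_periodPair {μ τ : ℂ} (hμ : μ ≠ 0) (hτ : 0 < τ.im) :
    (periodPair hμ hτ).g₃ = (μ ^ 6)⁻¹ * (8 * Real.pi ^ 6 / 27 * ModularForm.E₆ ⟨τ, hτ⟩) := by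
  rw [PeriodPair.g₃, G_periodPair hμ hτ (k := 6) (by norm_num)]
  push_cast
  rw [riemannZeta_six]
  ring

/-! ### Surjectivity of the modular invariant -/

open ModularForm UpperHalfPlane in
-- The limit is the constant term of the `q`-expansion.
lemma tendsto_E_atImInfty {k : ℕ} (hk : 3 ≤ k) (hk2 : Even k) :
    Tendsto (E hk) atImInfty (𝓝 1) := by
  have hΓ : (1 : ℝ) ∈ (𝒮ℒ).strictPeriods := one_mem_strictPeriods_SL
  have hanal := ModularFormClass.analyticAt_cuspFunction_zero (E hk) one_pos hΓ
  have h0 : cuspFunction 1 (E hk) 0 = 1 := by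
    have := EisensteinSeries.E_qExpansion_coeff_zero hk hk2
    simpa [qExpansion_coeff] using this
  rw [← h0]
  exact (hanal.continuousAt.tendsto.comp (qParam_tendsto_atImInfty one_pos)).congr
    (fun τ ↦ SlashInvariantFormClass.eq_cuspFunction (E hk) τ hΓ one_ne_zero)

open ModularForm UpperHalfPlane in
/-- The modular invariant takes every value. -/
lemma exists_E₄_cube_eq (c : ℂ) : ∃ τ : ℍ, E₄ τ ^ 3 = c * (E₄ τ ^ 3 - E₆ τ ^ 2) := by
  by_contra! hne
  -- If the value `c` is omitted, this form of weight 12 has no zero on `ℍ` and tends to `1` at the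
  -- cusp. Then `E₄ / N` is a level one modular form of weight `-8`, hence zero, which contradicts
  -- `E₄ ≠ 0`.
  let N : ModularForm 𝒮ℒ 12 := (1 - c) • ModularForm.mcast (by decide) (E₄.pow 3) +
    c • ModularForm.mcast (by decide) (E₆.pow 2)
  have hN (τ : ℍ) : N τ = (1 - c) * E₄ τ ^ 3 + c * E₆ τ ^ 2 := rfl
  have hN0 (τ : ℍ) : N τ ≠ 0 := fun h => hne τ <| by
    rw [hN] at h
    linear_combination h
  have hlim : Tendsto N atImInfty (𝓝 1) := by
    have h4 := tendsto_E_atImInfty (k := 4) (by norm_num) (by decide)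
    have h6 := tendsto_E_atImInfty (k := 6) (by norm_num) (by decide)
    have := ((h4.pow 3).const_mul (1 - c)).add ((h6.pow 2).const_mul c)
    simpa using this.congr fun τ => (hN τ).symm
  have hslash (γ : SL(2, ℤ)) : (fun τ => E₄ τ / N τ) ∣[(-8 : ℤ)] γ = fun τ => E₄ τ / N τ := by
    have hγ : (γ : GL (Fin 2) ℝ) ∈ 𝒮ℒ := ⟨γ, rfl⟩
    change (⇑E₄ / ⇑N) ∣[(4 - 12 : ℤ)] γ = ⇑E₄ / ⇑N
    have h1 : (⇑E₄) ∣[(4 : ℤ)] γ = ⇑E₄ := SlashInvariantForm.slash_action_eqn _ _ hγ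
    have h2 : (⇑N) ∣[(12 : ℤ)] γ = ⇑N := SlashInvariantForm.slash_action_eqn _ _ hγ
    rw [div_slash_SL2, h1, h2]
  let Q : ModularForm 𝒮ℒ (-8) :=
    { toFun τ := E₄ τ / N τ
      slash_action_eq' := fun _ ⟨γ, hγ⟩ ↦ hγ ▸ hslash γ
      holo' := E₄.holo'.div N.holo' hN0
      bdd_at_cusps' {c} hc := by
        rw [Subgroup.IsArithmetic.isCusp_iff_isCusp_SL2Z] at hc
        rw [OnePoint.isBoundedAt_iff_forall_SL2Z hc]
        intro γ _
        rw [hslash γ, IsBoundedAtImInfty, BoundedAtFilter]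
        have := (tendsto_E_atImInfty (k := 4) (by norm_num) (by decide)).div hlim one_ne_zero
        exact this.isBigO_one ℝ }
  have hQ : ⇑Q = 0 := ModularFormClass.levelOne_neg_weight_eq_zero (by norm_num) Q
  refine EisensteinSeries.E_ne_zero (k := 4) (by norm_num) (by decide) ?_
  ext τ
  have : E₄ τ / N τ = 0 := congrFun hQ τ
  simpa [hN0] using this

/-- Every pair `(a, b)` with `a³ ≠ 27 b²` is the pair of invariants of a lattice. -/
lemma exists_periodPair (a b : ℂ) (h : a ^ 3 - 27 * b ^ 2 ≠ 0) :
    ∃ (μ τ : ℂ) (hμ : μ ≠ 0) (hτ : 0 < τ.im),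
      (periodPair hμ hτ).g₂ = a ∧ (periodPair hμ hτ).g₃ = b := by
  -- `τ` is chosen with the modular invariant prescribed by `(a, b)`; what remains is a rescaling by
  -- `μ`.
  obtain ⟨⟨τ, hτ⟩, hj⟩ := exists_E₄_cube_eq (a ^ 3 / (a ^ 3 - 27 * b ^ 2))
  have hΔ := ModularForm.discriminant_ne_zero ⟨τ, hτ⟩
  rw [ModularForm.discriminant_eq_E₄_cube_sub_E₆_sq] at hΔ
  set e₄ := ModularForm.E₄ ⟨τ, hτ⟩
  set e₆ := ModularForm.E₆ ⟨τ, hτ⟩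
  have hpi : (Real.pi : ℂ) ≠ 0 := by exact_mod_cast Real.pi_ne_zero
  obtain ⟨p, hp⟩ : ∃ p, p = 4 * (Real.pi : ℂ) ^ 4 / 3 * e₄ := ⟨_, rfl⟩
  obtain ⟨q, hq⟩ : ∃ q, q = 8 * (Real.pi : ℂ) ^ 6 / 27 * e₆ := ⟨_, rfl⟩
  have hpq : p ^ 3 - 27 * q ^ 2 ≠ 0 := by
    have : p ^ 3 - 27 * q ^ 2 =
        (64 * 1728 / 27 * (Real.pi : ℂ) ^ 12) * ((e₄ ^ 3 - e₆ ^ 2) / 1728) := by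
      rw [hp, hq]; ring
    rw [this]
    exact mul_ne_zero (by simp [hpi]) hΔ
  have hrel : p ^ 3 * b ^ 2 = a ^ 3 * q ^ 2 := by
    field_simp at hj
    rw [hp, hq]
    linear_combination (-64 / 729) * (Real.pi : ℂ) ^ 12 * hj
  suffices ∃ μ : ℂ, μ ≠ 0 ∧ p = μ ^ 4 * a ∧ q = μ ^ 6 * b by
    obtain ⟨μ, hμ, h4, h6⟩ := this
    refine ⟨μ, τ, hμ, hτ, ?_, ?_⟩
    · rw [g₂_periodPair, ← hp, h4, inv_mul_cancel_left₀ (pow_ne_zero _ hμ)]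
    · rw [g₃_periodPair, ← hq, h6, inv_mul_cancel_left₀ (pow_ne_zero _ hμ)]
  by_cases ha : a = 0
  · subst ha
    have hb : b ≠ 0 := by rintro rfl; simp at h
    have hp0 : p = 0 := by simpa [hb] using hrel
    have hq0 : q ≠ 0 := by rintro rfl; simp [hp0] at hpq
    obtain ⟨μ, hμ⟩ := IsAlgClosed.exists_pow_nat_eq (q / b) (n := 6) (by norm_num)
    refine ⟨μ, ?_, by simp [hp0], by rw [hμ]; field_simp⟩
    rintro rfl
    simp [eq_comm, hq0, hb] at hμ
  · have hp0 : p ≠ 0 := by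
      rintro rfl
      have : q = 0 := by simpa [ha] using hrel.symm
      simp [this] at hpq
    obtain ⟨μ, hμ⟩ := IsAlgClosed.exists_pow_nat_eq (p / a) (n := 4) (by norm_num)
    have hμ0 : μ ≠ 0 := by
      rintro rfl
      simp [eq_comm, hp0, ha] at hμ
    have h4 : p = μ ^ 4 * a := by rw [hμ]; field_simp
    have h12 : (μ ^ 6 * b) ^ 2 = q ^ 2 := by
      have : a ^ 3 * ((μ ^ 6 * b) ^ 2 - q ^ 2) = 0 := by
        rw [h4] at hrel
        linear_combination hrel
      have := (mul_eq_zero.1 this).resolve_left (pow_ne_zero _ ha)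
      linear_combination this
    -- `μ ^ 4` fixes `μ ^ 6` only up to sign. Replacing `μ` by `iμ` keeps `μ ^ 4` and reverses that
    -- sign.
    rcases sq_eq_sq_iff_eq_or_eq_neg.1 h12 with h6 | h6
    · exact ⟨μ, hμ0, h4, h6.symm⟩
    · refine ⟨Complex.I * μ, mul_ne_zero Complex.I_ne_zero hμ0, ?_, ?_⟩
      · rw [mul_pow, Complex.I_pow_four, one_mul, h4]
      · rw [mul_pow, show Complex.I ^ 6 = -1 by
          rw [show 6 = 4 + 2 by norm_num, pow_add, Complex.I_pow_four, Complex.I_sq, one_mul]]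
        linear_combination h6


/-! ### The lattice is determined by its invariants -/

/-- A singular first order equation `z A D' = B D` has no nonzero analytic solution at `0`
when `B 0 / A 0` is not a natural number. -/
lemma eventually_eq_zero_of_euler {D A B : ℂ → ℂ} (hD : AnalyticAt ℂ D 0)
    (hA : ContinuousAt A 0) (hB : ContinuousAt B 0)
    (h : ∀ᶠ z in 𝓝[≠] 0, z * A z * deriv D z = B z * D z)
    (hne : ∀ n : ℕ, n * A 0 ≠ B 0) : ∀ᶠ z in 𝓝 0, D z = 0 := by
  by_contra hD0
  -- With `D = z ^ n g` and `g 0 ≠ 0`, dividing the equation by `z ^ n` and letting `z → 0` gives `n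
  -- A(0) = B(0)`.
  obtain ⟨n, g, hg, hg0, hgD⟩ := (hD.exists_eventuallyEq_pow_smul_nonzero_iff).2 hD0
  simp only [sub_zero, smul_eq_mul] at hgD
  have hg' : ContinuousAt (deriv g) 0 := hg.deriv.continuousAt
  have key : ∀ᶠ z in 𝓝[≠] (0 : ℂ), A z * (n * g z + z * deriv g z) = B z * g z := by
    have e1 : ∀ᶠ z in 𝓝[≠] (0 : ℂ), ∀ᶠ y in 𝓝 z, D y = y ^ n * g y :=
      (eventually_eventually_nhds.2 hgD).filter_mono nhdsWithin_le_nhds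
    have e2 : ∀ᶠ z in 𝓝[≠] (0 : ℂ), AnalyticAt ℂ g z :=
      hg.eventually_analyticAt.filter_mono nhdsWithin_le_nhds
    filter_upwards [h, e1, e2, self_mem_nhdsWithin] with z hz h1 h2 hz0
    have hz0 : z ≠ 0 := hz0
    have hd : deriv D z = n * z ^ (n - 1) * g z + z ^ n * deriv g z := by
      have : HasDerivAt (fun y => y ^ n * g y) (n * z ^ (n - 1) * g z + z ^ n * deriv g z) z :=
        (hasDerivAt_pow n z).mul h2.differentiableAt.hasDerivAt
      exact (this.congr_of_eventuallyEq h1).deriv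
    have hpow : z * (n * z ^ (n - 1)) = n * z ^ n := by
      rcases n with _ | n
      · simp
      · simp [pow_succ]; ring
    rw [hd, h1.self_of_nhds] at hz
    have : z ^ n * (A z * (n * g z + z * deriv g z)) = z ^ n * (B z * g z) := by
      linear_combination hz - A z * g z * hpow
    exact mul_left_cancel₀ (pow_ne_zero _ hz0) this
  have l1 : Tendsto (fun z => A z * (n * g z + z * deriv g z)) (𝓝[≠] 0)
      (𝓝 (A 0 * (n * g 0 + 0 * deriv g 0))) :=
    ((hA.mul ((continuousAt_const.mul hg.continuousAt).add
      (continuousAt_id.mul hg'))).tendsto).mono_left nhdsWithin_le_nhds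
  have l2 : Tendsto (fun z => B z * g z) (𝓝[≠] 0) (𝓝 (B 0 * g 0)) :=
    ((hB.mul hg.continuousAt).tendsto).mono_left nhdsWithin_le_nhds
  have := tendsto_nhds_unique (l1.congr' key) l2
  apply hne n
  apply mul_right_cancel₀ hg0
  linear_combination this

lemma weierstrassP_eq_add (L : PeriodPair) (z : ℂ) :
    L.weierstrassP z = L.weierstrassPExcept 0 z + 1 / z ^ 2 := by
  have := L.weierstrassPExcept_def 0 z
  simp only [ZeroMemClass.coe_zero] at this
  rw [this]; simp

lemma derivWeierstrassP_eq_sub (L : PeriodPair) (z : ℂ) :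
    L.derivWeierstrassP z = L.derivWeierstrassPExcept 0 z - 2 / z ^ 3 := by
  have := L.derivWeierstrassPExcept_def 0 z
  simp only [ZeroMemClass.coe_zero] at this
  rw [this]; simp

lemma lattice_diff_zero_notMem_nhds (L : PeriodPair) :
    ∀ᶠ z in 𝓝 (0 : ℂ), z ∈ ((L.lattice : Set ℂ) \ {0})ᶜ :=
  L.compl_lattice_sdiff_singleton_mem_nhds 0

/-- Put `℘_L = p + z⁻²` and `℘_M = q + z⁻²`. Subtracting the two equations gives a singular linear
equation for `p - q` with `A(0) = -4`, `B(0) = 12`. Its exponent `-3` is not a natural number, so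
the difference vanishes near `0`. -/
lemma eventually_weierstrassP_eq {L M : PeriodPair} {a b : ℂ}
    (hL : ∀ z, z ∉ L.lattice →
      L.derivWeierstrassP z ^ 2 = 4 * L.weierstrassP z ^ 3 - a * L.weierstrassP z - b)
    (hM : ∀ z, z ∉ M.lattice →
      M.derivWeierstrassP z ^ 2 = 4 * M.weierstrassP z ^ 3 - a * M.weierstrassP z - b) :
    ∀ᶠ z in 𝓝 0, L.weierstrassP z = M.weierstrassP z := by
  set p := L.weierstrassPExcept 0
  set q := M.weierstrassPExcept 0
  set p' := L.derivWeierstrassPExcept 0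
  set q' := M.derivWeierstrassPExcept 0
  have hp : AnalyticAt ℂ p 0 := L.analyticAt_weierstrassPExcept 0
  have hq : AnalyticAt ℂ q 0 := M.analyticAt_weierstrassPExcept 0
  have hp' : AnalyticAt ℂ p' 0 := L.analyticAt_derivWeierstrassPExcept 0
  have hq' : AnalyticAt ℂ q' 0 := M.analyticAt_derivWeierstrassPExcept 0
  have := eventually_eq_zero_of_euler (D := fun z => p z - q z)
    (A := fun z => z ^ 3 * (p' z + q' z) - 4)
    (B := fun z => 4 * ((z ^ 2 * p z + 1) ^ 2 + (z ^ 2 * p z + 1) * (z ^ 2 * q z + 1) +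
      (z ^ 2 * q z + 1) ^ 2) - a * z ^ 4) (hp.sub hq)
    (by have := hp'.continuousAt; have := hq'.continuousAt; fun_prop)
    (by have := hp.continuousAt; have := hq.continuousAt; fun_prop) ?_ ?_
  · filter_upwards [this] with z hz
    rw [weierstrassP_eq_add, weierstrassP_eq_add]
    linear_combination hz
  · filter_upwards [(lattice_diff_zero_notMem_nhds L).filter_mono nhdsWithin_le_nhds,
      (lattice_diff_zero_notMem_nhds M).filter_mono nhdsWithin_le_nhds,
      hp.eventually_analyticAt.filter_mono nhdsWithin_le_nhds,
      hq.eventually_analyticAt.filter_mono nhdsWithin_le_nhds,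
      self_mem_nhdsWithin] with z h1 h2 h3 h4 hz
    have hz : z ≠ 0 := hz
    have d1 : deriv p z = p' z := L.eqOn_deriv_weierstrassPExcept_derivWeierstrassPExcept 0 h1
    have d2 : deriv q z = q' z := M.eqOn_deriv_weierstrassPExcept_derivWeierstrassPExcept 0 h2
    have hd : deriv (fun z => p z - q z) z = p' z - q' z := by
      rw [← d1, ← d2]
      exact deriv_fun_sub h3.differentiableAt h4.differentiableAt
    have e1 := hL z (fun h => h1 ⟨h, hz⟩)
    have e2 := hM z (fun h => h2 ⟨h, hz⟩)
    rw [weierstrassP_eq_add, derivWeierstrassP_eq_sub] at e1 e2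
    rw [hd]
    change (p' z - 2 / z ^ 3) ^ 2 = 4 * (p z + 1 / z ^ 2) ^ 3 - a * (p z + 1 / z ^ 2) - b at e1
    change (q' z - 2 / z ^ 3) ^ 2 = 4 * (q z + 1 / z ^ 2) ^ 3 - a * (q z + 1 / z ^ 2) - b at e2
    have e3 : (p' z - 2 / z ^ 3) ^ 2 - (q' z - 2 / z ^ 3) ^ 2 =
      4 * (p z + 1 / z ^ 2) ^ 3 - a * (p z + 1 / z ^ 2)
        - (4 * (q z + 1 / z ^ 2) ^ 3 - a * (q z + 1 / z ^ 2)) := by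
      rw [e1, e2]; ring
    clear e1 e2
    field_simp at e3
    have e4 : z ^ 2 * (z * (z ^ 3 * (p' z + q' z) - 4) * (p' z - q' z)) =
        z ^ 2 * ((4 * ((z ^ 2 * p z + 1) ^ 2 + (z ^ 2 * p z + 1) * (z ^ 2 * q z + 1) +
      (z ^ 2 * q z + 1) ^ 2) - a * z ^ 4) * (p z - q z)) := by
      linear_combination e3
    exact mul_left_cancel₀ (pow_ne_zero 2 hz) e4
  · intro n h
    norm_num at h
    have : (n : ℂ) * 4 + 12 = 0 := by linear_combination -h
    norm_cast at this

lemma countable_lattice (L : PeriodPair) : (L.lattice : Set ℂ).Countable := by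
  have : Countable L.lattice := L.latticeEquivProd.toEquiv.countable_iff.2 inferInstance
  exact this.to_set

/-- The complement of a countable set in the plane is connected, so the identity theorem applies. -/
lemma weierstrassP_eqOn {L M : PeriodPair}
    (h : ∀ᶠ z in 𝓝 0, L.weierstrassP z = M.weierstrassP z) :
    EqOn L.weierstrassP M.weierstrassP ((L.lattice : Set ℂ) ∪ M.lattice)ᶜ := by
  have hconn : IsPreconnected ((L.lattice : Set ℂ) ∪ M.lattice)ᶜ := by
    refine (((countable_lattice L).union (countable_lattice M)).isConnected_compl_of_one_lt_rank
      ?_).isPreconnected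
    simp [Complex.rank_real_complex]
  obtain ⟨z, h1, h2⟩ : ∃ z, z ∈ ((L.lattice : Set ℂ) ∪ M.lattice)ᶜ ∧
      ∀ᶠ y in 𝓝 z, L.weierstrassP y = M.weierstrassP y := by
    have e : ∀ᶠ z in 𝓝[≠] (0 : ℂ), z ∈ ((L.lattice : Set ℂ) ∪ M.lattice)ᶜ ∧
      ∀ᶠ y in 𝓝 z, L.weierstrassP y = M.weierstrassP y := by
      filter_upwards [(lattice_diff_zero_notMem_nhds L).filter_mono nhdsWithin_le_nhds,
        (lattice_diff_zero_notMem_nhds M).filter_mono nhdsWithin_le_nhds, self_mem_nhdsWithin,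
        (eventually_eventually_nhds.2 h).filter_mono nhdsWithin_le_nhds] with z h1 h2 hz h3
      refine ⟨?_, h3⟩
      rintro (h | h)
      · exact h1 ⟨h, hz⟩
      · exact h2 ⟨h, hz⟩
    exact e.exists
  refine AnalyticOnNhd.eqOn_of_preconnected_of_eventuallyEq
    (L.analyticOnNhd_weierstrassP.mono ?_) (M.analyticOnNhd_weierstrassP.mono ?_) hconn h1 h2
  · exact compl_subset_compl.2 subset_union_left
  · exact compl_subset_compl.2 subset_union_right

/-- A point of `L.lattice` outside `M.lattice` would be a pole of the first function and a regular
point of the second. -/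
lemma lattice_le_of_weierstrassP_eqOn {L M : PeriodPair}
    (h : EqOn L.weierstrassP M.weierstrassP ((L.lattice : Set ℂ) ∪ M.lattice)ᶜ) :
    L.lattice ≤ M.lattice := by
  intro l hl
  by_contra hlM
  have hev : L.weierstrassP =ᶠ[𝓝[≠] l] M.weierstrassP := by
    filter_upwards [mem_nhdsWithin_of_mem_nhds (L.compl_lattice_sdiff_singleton_mem_nhds l),
      mem_nhdsWithin_of_mem_nhds (M.compl_lattice_sdiff_singleton_mem_nhds l),
      self_mem_nhdsWithin] with z h1 h2 hz
    apply h
    rintro (h | h)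
    · exact h1 ⟨h, hz⟩
    · exact h2 ⟨h, hz⟩
  have h1 := L.order_weierstrassP l hl
  rw [meromorphicOrderAt_congr hev] at h1
  have h2 := (M.analyticOnNhd_weierstrassP l hlM).meromorphicOrderAt_nonneg
  rw [h1] at h2
  exact absurd h2 (by decide)

/-- The lattice of a Weierstrass function is determined by its differential equation. -/
theorem lattice_eq_of_ode {L M : PeriodPair} {a b : ℂ}
    (hL : ∀ z, z ∉ L.lattice →
      L.derivWeierstrassP z ^ 2 = 4 * L.weierstrassP z ^ 3 - a * L.weierstrassP z - b)
    (hM : ∀ z, z ∉ M.lattice →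
      M.derivWeierstrassP z ^ 2 = 4 * M.weierstrassP z ^ 3 - a * M.weierstrassP z - b) :
    L.lattice = M.lattice :=
  le_antisymm
    (lattice_le_of_weierstrassP_eqOn (weierstrassP_eqOn (eventually_weierstrassP_eq hL hM)))
    (lattice_le_of_weierstrassP_eqOn (weierstrassP_eqOn (eventually_weierstrassP_eq hM hL)))


/-! ### Local inversion of injective holomorphic functions -/

/-- Dividing by `F a` brings the value at `a` to `1`, away from the branch cut of the power. -/
lemma exists_analyticAt_root {F : ℂ → ℂ} {a c : ℂ} {k : ℕ} (hk : k ≠ 0) (hF : AnalyticAt ℂ F a)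
    (hFa : F a ≠ 0) (hc : c ^ k = F a) :
    ∃ ρ : ℂ → ℂ, AnalyticAt ℂ ρ a ∧ ρ a = c ∧ ∀ z, ρ z ^ k = F z := by
  refine ⟨fun z => c * (F z / F a) ^ ((k : ℂ)⁻¹), ?_, ?_, fun z => ?_⟩
  · refine analyticAt_const.mul ((hF.div analyticAt_const hFa).cpow analyticAt_const ?_)
    simp [hFa]
  · simp [hFa]
  · rw [mul_pow, Complex.cpow_nat_inv_pow _ hk, hc]
    field_simp

/-- An injective holomorphic function has no critical point. -/
lemma deriv_ne_zero_of_injOn {H : ℂ → ℂ} {a : ℂ} (hH : AnalyticAt ℂ H a) {U : Set ℂ}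
    (hU : U ∈ 𝓝 a) (hinj : InjOn H U) : deriv H a ≠ 0 := by
  have hF : AnalyticAt ℂ (fun z => H z - H a) a := hH.sub analyticAt_const
  have hF0 : ¬ ∀ᶠ z in 𝓝 a, H z - H a = 0 := by
    intro h
    have h1 : ∀ᶠ z in 𝓝[≠] a, H z - H a = 0 ∧ z ∈ U ∧ z ≠ a := by
      filter_upwards [h.filter_mono nhdsWithin_le_nhds, mem_nhdsWithin_of_mem_nhds hU,
        self_mem_nhdsWithin] with z h1 h2 h3 using ⟨h1, h2, h3⟩
    obtain ⟨z, h1, h2, h3⟩ := h1.exists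
    exact h3 (hinj h2 (mem_of_mem_nhds hU) (sub_eq_zero.1 h1))
  obtain ⟨n, g, hg, hg0, hgF⟩ := (hF.exists_eventuallyEq_pow_smul_nonzero_iff).2 hF0
  simp only [smul_eq_mul] at hgF
  have hn : n ≠ 0 := by
    rintro rfl
    have := hgF.self_of_nhds
    simp [hg0, eq_comm] at this
  obtain ⟨c, hc⟩ := IsAlgClosed.exists_pow_nat_eq (g a) (Nat.pos_of_ne_zero hn)
  have hc0 : c ≠ 0 := by
    rintro rfl
    simp [hn, eq_comm, hg0] at hc
  obtain ⟨ρ, hρ, hρa, hρg⟩ := exists_analyticAt_root hn hg hg0 hc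
  set φ : ℂ → ℂ := fun z => (z - a) * ρ z with hφ
  have hφa : φ a = 0 := by simp [hφ]
  have hφan : AnalyticAt ℂ φ a := (analyticAt_id.sub analyticAt_const).mul hρ
  have hφd : HasStrictDerivAt φ c a := by
    have h1 := hφan.hasStrictDerivAt
    have h2 : HasDerivAt φ (1 * ρ a + (a - a) * deriv ρ a) a :=
      ((hasDerivAt_id a).sub_const a).mul hρ.differentiableAt.hasDerivAt
    rw [h2.deriv] at h1
    simpa [hρa] using h1
  have hHφ : ∀ᶠ z in 𝓝 a, H z = H a + φ z ^ n := by
    filter_upwards [hgF] with z hz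
    rw [hφ, mul_pow, hρg, ← hz]; ring
  by_cases hn1 : n = 1
  · have h3 : HasDerivAt H c a := by
      have : HasDerivAt (fun z => H a + φ z ^ n) c a := by
        simpa [hn1] using hφd.hasDerivAt.const_add (H a)
      exact this.congr_of_eventuallyEq hHφ
    rwa [h3.deriv]
  exfalso
  -- Near `a`, `H = H a + φ ^ n` with `φ` locally onto. For a root of unity `e ≠ 1`, the points
  -- where `φ` takes the values `w` and `e w` have the same image under `H`.
  obtain ⟨e, he⟩ : ∃ e : ℂ, IsPrimitiveRoot e n := ⟨_, Complex.isPrimitiveRoot_exp n hn⟩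
  have he1 : e ≠ 1 := fun h => hn1 (by
    have := he.eq_orderOf
    simpa [h] using this)
  have himg : φ '' (U ∩ {z | H z = H a + φ z ^ n}) ∈ 𝓝 (0 : ℂ) := by
    rw [← hφa, ← hφd.map_nhds_eq hc0]
    exact image_mem_map (inter_mem hU hHφ)
  have himg2 : ∀ᶠ w in 𝓝 (0 : ℂ), e * w ∈ φ '' (U ∩ {z | H z = H a + φ z ^ n}) := by
    have : Tendsto (fun w => e * w) (𝓝 0) (𝓝 (0 : ℂ)) := by
      have := (continuous_const_mul e).tendsto (0 : ℂ)
      simpa using this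
    exact this.eventually himg
  have hex : ∀ᶠ w in 𝓝[≠] (0 : ℂ), w ∈ φ '' (U ∩ {z | H z = H a + φ z ^ n}) ∧
      e * w ∈ φ '' (U ∩ {z | H z = H a + φ z ^ n}) ∧ w ≠ 0 := by
    filter_upwards [mem_nhdsWithin_of_mem_nhds himg, himg2.filter_mono nhdsWithin_le_nhds,
      self_mem_nhdsWithin] with w h1 h2 h3 using ⟨h1, h2, h3⟩
  obtain ⟨w, ⟨x, ⟨hxU, hx⟩, hxw⟩, ⟨y, ⟨hyU, hy⟩, hyw⟩, hw⟩ := hex.exists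
  have hx : H x = H a + φ x ^ n := hx
  have hy : H y = H a + φ y ^ n := hy
  have : x = y := by
    apply hinj hxU hyU
    rw [hx, hy, hxw, hyw, mul_pow, he.pow_eq_one, one_mul]
  rw [← this, hxw] at hyw
  exact he1 (mul_right_cancel₀ hw (by rw [one_mul, ← hyw]))

lemma exists_local_inverse {H : ℂ → ℂ} {a : ℂ} (hH : AnalyticAt ℂ H a) {U : Set ℂ}
    (hU : U ∈ 𝓝 a) (hinj : InjOn H U) :
    ∃ T : ℂ → ℂ, AnalyticAt ℂ T (H a) ∧ T (H a) = a ∧ ∀ᶠ w in 𝓝 (H a), H (T w) = w := by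
  have hd := deriv_ne_zero_of_injOn hH hU hinj
  refine ⟨hH.hasStrictDerivAt.localInverse H (deriv H a) a hd, ?_, ?_, ?_⟩
  · exact hH.analyticAt_localInverse hd
  · exact HasStrictFDerivAt.localInverse_apply_image ..
  · exact hH.hasStrictDerivAt.eventually_right_inverse hd

/-- Two weighted homogeneous conditions `P (τ z) = μ ^ k p`, `Q (τ z) = μ ^ l q` can be solved for
holomorphic `τ` and `μ` if `(τ, μ)` is locally determined by them. -/
lemma exists_analyticAt_solution {P Q p q : ℂ → ℂ} {τ₀ μ₀ z₀ : ℂ} {k l : ℕ} (hk : k ≠ 0)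
    (hP : AnalyticAt ℂ P τ₀) (hQ : AnalyticAt ℂ Q τ₀) (hp : AnalyticAt ℂ p z₀)
    (hq : AnalyticAt ℂ q z₀) (hμ₀ : μ₀ ≠ 0) (hp₀ : p z₀ ≠ 0)
    (hP₀ : P τ₀ = μ₀ ^ k * p z₀) (hQ₀ : Q τ₀ = μ₀ ^ l * q z₀)
    (hrigid : ∀ᶠ x : (ℂ × ℂ) × ℂ in 𝓝 ((τ₀, τ₀), 1), P x.1.2 = x.2 ^ k * P x.1.1 →
      Q x.1.2 = x.2 ^ l * Q x.1.1 → x.1.1 = x.1.2) :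
    ∃ τ μ : ℂ → ℂ, AnalyticAt ℂ τ z₀ ∧ AnalyticAt ℂ μ z₀ ∧ τ z₀ = τ₀ ∧ μ z₀ = μ₀ ∧
      ∀ᶠ z in 𝓝 z₀, P (τ z) = μ z ^ k * p z ∧ Q (τ z) = μ z ^ l * q z := by
  have hP0 : P τ₀ ≠ 0 := by rw [hP₀]; exact mul_ne_zero (pow_ne_zero _ hμ₀) hp₀
  obtain ⟨s₀, hs₀⟩ := IsAlgClosed.exists_pow_nat_eq (p z₀) (Nat.pos_of_ne_zero hk)
  have hs₀0 : s₀ ≠ 0 := by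
    rintro rfl
    simp [hk, eq_comm, hp₀] at hs₀
  obtain ⟨s, hs, hsz, hsp⟩ := exists_analyticAt_root hk hp hp₀ hs₀
  obtain ⟨r, hr, hrτ, hrP⟩ := exists_analyticAt_root (c := μ₀ * s₀) hk hP hP0
    (by rw [mul_pow, hs₀, hP₀])
  have hr0 : r τ₀ ≠ 0 := by rw [hrτ]; exact mul_ne_zero hμ₀ hs₀0
  -- With `r ^ k = P` and `s ^ k = p`, the choice `μ = r(τ) / s` solves the first condition, and the
  -- second becomes `H(τ) = q / s ^ l`. The rigidity hypothesis makes `H` injective near `τ₀`.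
  set H : ℂ → ℂ := fun x => Q x / r x ^ l with hH
  have hHan : AnalyticAt ℂ H τ₀ := hQ.div (hr.pow l) (pow_ne_zero _ hr0)
  have hlim : Tendsto (fun x : ℂ × ℂ => (x, r x.2 / r x.1)) (𝓝 (τ₀, τ₀))
      (𝓝 ((τ₀, τ₀), 1)) := by
    have h1 : ContinuousAt (fun x : ℂ × ℂ => r x.1) (τ₀, τ₀) :=
      ContinuousAt.comp (f := Prod.fst) hr.continuousAt continuousAt_fst
    have h2 : ContinuousAt (fun x : ℂ × ℂ => r x.2) (τ₀, τ₀) :=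
      ContinuousAt.comp (f := Prod.snd) hr.continuousAt continuousAt_snd
    have h3 : ContinuousAt (fun x : ℂ × ℂ => (x, r x.2 / r x.1)) (τ₀, τ₀) :=
      continuousAt_id.prodMk (h2.div h1 hr0)
    simpa [ContinuousAt, hr0] using h3
  obtain ⟨U, hU, hUinj⟩ : ∃ U ∈ 𝓝 τ₀, InjOn H U := by
    have hne : ∀ᶠ x in 𝓝 τ₀, r x ≠ 0 := hr.continuousAt.eventually_ne hr0
    have h1 := hlim.eventually hrigid
    rw [nhds_prod_eq] at h1
    obtain ⟨U, hU, h2⟩ := (eventually_prod_self_iff (r := fun a b : ℂ =>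
      P b = (r b / r a) ^ k * P a → Q b = (r b / r a) ^ l * Q a → a = b)).1 h1
    refine ⟨U ∩ {x | r x ≠ 0}, inter_mem hU hne, ?_⟩
    rintro x ⟨hx, hx0⟩ y ⟨hy, hy0⟩ hxy
    have hx0 : r x ≠ 0 := hx0
    have hy0 : r y ≠ 0 := hy0
    refine h2 x hx y hy ?_ ?_
    · simp only [← hrP, div_pow]
      field_simp
    · simp only [hH] at hxy
      simp only [div_pow]
      field_simp at hxy ⊢
      linear_combination -hxy
  obtain ⟨T, hT, hTτ, hTH⟩ := exists_local_inverse hHan hU hUinj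
  have hK : AnalyticAt ℂ (fun z => q z / s z ^ l) z₀ :=
    hq.div (hs.pow l) (pow_ne_zero _ (by rwa [hsz]))
  have hKz : q z₀ / s z₀ ^ l = H τ₀ := by
    simp only [hH]
    rw [hQ₀, hrτ, hsz, mul_pow]
    field_simp
  have hTan : AnalyticAt ℂ (fun z => T (q z / s z ^ l)) z₀ := by
    refine AnalyticAt.fun_comp (g := T) (f := fun z => q z / s z ^ l) ?_ hK
    rwa [hKz]
  have hTz : T (q z₀ / s z₀ ^ l) = τ₀ := by rw [hKz, hTτ]
  refine ⟨fun z => T (q z / s z ^ l), fun z => r (T (q z / s z ^ l)) / s z, hTan, ?_, hTz, ?_, ?_⟩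
  · refine AnalyticAt.div (AnalyticAt.fun_comp (g := r) ?_ hTan) hs (by rwa [hsz])
    rwa [hTz]
  · change r (T (q z₀ / s z₀ ^ l)) / s z₀ = μ₀
    rw [hTz, hrτ, hsz, mul_div_assoc, div_self hs₀0, mul_one]
  · have h1 : ∀ᶠ z in 𝓝 z₀, H (T (q z / s z ^ l)) = q z / s z ^ l := by
      have : Tendsto (fun z => q z / s z ^ l) (𝓝 z₀) (𝓝 (H τ₀)) := by
        rw [← hKz]; exact hK.continuousAt
      exact this.eventually hTH
    have h2 : ∀ᶠ z in 𝓝 z₀, s z ≠ 0 := hs.continuousAt.eventually_ne (by rwa [hsz])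
    have h3 : ∀ᶠ z in 𝓝 z₀, r (T (q z / s z ^ l)) ≠ 0 := by
      refine ContinuousAt.eventually_ne (g := fun z => r (T (q z / s z ^ l)))
        (AnalyticAt.continuousAt (𝕜 := ℂ) (AnalyticAt.fun_comp (g := r) ?_ hTan)) ?_
      · rwa [hTz]
      · rwa [hTz]
    filter_upwards [h1, h2, h3] with z h1 h2 h3
    constructor
    · rw [← hrP, ← hsp, div_pow]; field_simp
    · simp only [hH] at h1
      rw [div_pow]
      field_simp at h1 ⊢
      linear_combination h1


/-! ### Existence of frames -/

/-- The invariants `g₂`, `g₃` of the lattice `ℤ + ℤ τ`. -/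
noncomputable def invG₂ (τ : ℂ) : ℂ :=
  4 * Real.pi ^ 4 / 3 * ModularForm.E₄ (UpperHalfPlane.ofComplex τ)
noncomputable def invG₃ (τ : ℂ) : ℂ :=
  8 * Real.pi ^ 6 / 27 * ModularForm.E₆ (UpperHalfPlane.ofComplex τ)

lemma analyticAt_modularForm {k : ℤ} (f : ModularForm 𝒮ℒ k) {τ : ℂ} (hτ : 0 < τ.im) :
    AnalyticAt ℂ (fun z => f (UpperHalfPlane.ofComplex z)) τ :=
  (UpperHalfPlane.mdifferentiable_iff.1 f.holo').analyticOnNhd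
    UpperHalfPlane.isOpen_upperHalfPlaneSet τ hτ

lemma analyticAt_invG₂ {τ : ℂ} (hτ : 0 < τ.im) : AnalyticAt ℂ invG₂ τ :=
  analyticAt_const.mul (analyticAt_modularForm _ hτ)

lemma analyticAt_invG₃ {τ : ℂ} (hτ : 0 < τ.im) : AnalyticAt ℂ invG₃ τ :=
  analyticAt_const.mul (analyticAt_modularForm _ hτ)

lemma g₂_periodPair_eq {μ τ : ℂ} (hμ : μ ≠ 0) (hτ : 0 < τ.im) :
    (periodPair hμ hτ).g₂ = (μ ^ 4)⁻¹ * invG₂ τ := by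
  rw [g₂_periodPair, invG₂, UpperHalfPlane.ofComplex_apply_of_im_pos hτ]

lemma g₃_periodPair_eq {μ τ : ℂ} (hμ : μ ≠ 0) (hτ : 0 < τ.im) :
    (periodPair hμ hτ).g₃ = (μ ^ 6)⁻¹ * invG₃ τ := by
  rw [g₃_periodPair, invG₃, UpperHalfPlane.ofComplex_apply_of_im_pos hτ]

lemma lattice_eq_of_invariants {L M : PeriodPair} (h₂ : L.g₂ = M.g₂) (h₃ : L.g₃ = M.g₃) :
    L.lattice = M.lattice :=
  lattice_eq_of_ode L.derivWeierstrassP_sq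
    (fun z hz => by rw [h₂, h₃]; exact M.derivWeierstrassP_sq z hz)

/-- `m + n τ` is close to `1` only if `m = 1` and `n = 0`. -/
lemma eq_one_of_norm_lt {τ : ℂ} {m n : ℤ} (h1 : ‖(m + n * τ : ℂ) - 1‖ < τ.im)
    (h2 : ‖(m + n * τ : ℂ) - 1‖ < 1) : m = 1 ∧ n = 0 := by
  have hn : n = 0 := by
    have h3 := (Complex.abs_im_le_norm ((m + n * τ : ℂ) - 1)).trans_lt h1
    have h4 : ((m + n * τ : ℂ) - 1).im = n * τ.im := by simp
    rw [h4, abs_mul] at h3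
    have hτ : 0 < τ.im := (norm_nonneg _).trans_lt h1
    rw [abs_of_pos hτ] at h3
    have h5 : |(n : ℝ)| < 1 := by
      by_contra h
      push Not at h
      nlinarith
    have : |n| < 1 := by exact_mod_cast h5
    exact Int.abs_lt_one_iff.1 this
  subst hn
  refine ⟨?_, rfl⟩
  have h3 : ‖((m - 1 : ℤ) : ℂ)‖ < 1 := by simpa using h2
  rw [Complex.norm_intCast] at h3
  have : |m - 1| < 1 := by exact_mod_cast h3
  have := Int.abs_lt_one_iff.1 this
  omega

/-- The two conditions say `ℤ + ℤ τ = c (ℤ + ℤ τ')`. With `c` near `1` and `c τ'` near `τ`,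
discreteness of the lattice forces `c = 1` and `τ' = τ`. -/
lemma invariants_rigid {τ₀ : ℂ} (hτ₀ : 0 < τ₀.im) :
    ∀ᶠ x : (ℂ × ℂ) × ℂ in 𝓝 ((τ₀, τ₀), 1), invG₂ x.1.2 = x.2 ^ 4 * invG₂ x.1.1 →
      invG₃ x.1.2 = x.2 ^ 6 * invG₃ x.1.1 → x.1.1 = x.1.2 := by
  have e1 : ∀ᶠ x : (ℂ × ℂ) × ℂ in 𝓝 ((τ₀, τ₀), 1), 0 < x.1.1.im :=
    ContinuousAt.eventually_lt (g := fun x : (ℂ × ℂ) × ℂ => x.1.1.im) continuousAt_const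
      (by fun_prop) hτ₀
  have e2 : ∀ᶠ x : (ℂ × ℂ) × ℂ in 𝓝 ((τ₀, τ₀), 1), 0 < x.1.2.im :=
    ContinuousAt.eventually_lt (g := fun x : (ℂ × ℂ) × ℂ => x.1.2.im) continuousAt_const
      (by fun_prop) hτ₀
  have e3 : ∀ᶠ x : (ℂ × ℂ) × ℂ in 𝓝 ((τ₀, τ₀), 1), x.2 ≠ 0 :=
    ContinuousAt.eventually_ne (g := fun x : (ℂ × ℂ) × ℂ => x.2) (by fun_prop) one_ne_zero
  have e4 : ∀ᶠ x : (ℂ × ℂ) × ℂ in 𝓝 ((τ₀, τ₀), 1), ‖x.2 - 1‖ < x.1.1.im :=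
    ContinuousAt.eventually_lt (f := fun x : (ℂ × ℂ) × ℂ => ‖x.2 - 1‖)
      (g := fun x : (ℂ × ℂ) × ℂ => x.1.1.im) (by fun_prop) (by fun_prop) (by simpa using hτ₀)
  have e5 : ∀ᶠ x : (ℂ × ℂ) × ℂ in 𝓝 ((τ₀, τ₀), 1), ‖x.2 - 1‖ < 1 :=
    ContinuousAt.eventually_lt (f := fun x : (ℂ × ℂ) × ℂ => ‖x.2 - 1‖)
      (g := fun x : (ℂ × ℂ) × ℂ => 1) (by fun_prop) (by fun_prop) (by simp)
  have e6 : ∀ᶠ x : (ℂ × ℂ) × ℂ in 𝓝 ((τ₀, τ₀), 1), ‖x.2 * x.1.2 - x.1.1‖ < x.1.1.im :=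
    ContinuousAt.eventually_lt (f := fun x : (ℂ × ℂ) × ℂ => ‖x.2 * x.1.2 - x.1.1‖)
      (g := fun x : (ℂ × ℂ) × ℂ => x.1.1.im) (by fun_prop) (by fun_prop) (by simpa using hτ₀)
  have e7 : ∀ᶠ x : (ℂ × ℂ) × ℂ in 𝓝 ((τ₀, τ₀), 1), ‖x.2 * x.1.2 - x.1.1‖ < 1 :=
    ContinuousAt.eventually_lt (f := fun x : (ℂ × ℂ) × ℂ => ‖x.2 * x.1.2 - x.1.1‖)
      (g := fun x : (ℂ × ℂ) × ℂ => 1) (by fun_prop) (by fun_prop) (by simp)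
  filter_upwards [e1, e2, e3, e4, e5, e6, e7] with ⟨⟨τ, τ'⟩, c⟩ h1 h2 h3 h4 h5 h6 h7 g2 g3
  simp only at h1 h2 h3 h4 h5 h6 h7 g2 g3 ⊢
  have hlat : (periodPair one_ne_zero h1).lattice = (periodPair h3 h2).lattice := by
    apply lattice_eq_of_invariants
    · rw [g₂_periodPair_eq, g₂_periodPair_eq, g2, inv_mul_cancel_left₀ (pow_ne_zero _ h3)]; simp
    · rw [g₃_periodPair_eq, g₃_periodPair_eq, g3, inv_mul_cancel_left₀ (pow_ne_zero _ h3)]; simp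
  have m1 : c ∈ (periodPair one_ne_zero h1).lattice := by
    rw [hlat, mem_periodPair_lattice]
    exact ⟨1, 0, by simp⟩
  have m2 : c * τ' ∈ (periodPair one_ne_zero h1).lattice := by
    rw [hlat, mem_periodPair_lattice]
    exact ⟨0, 1, by simp⟩
  rw [mem_periodPair_lattice] at m1 m2
  obtain ⟨m, n, hc⟩ := m1
  obtain ⟨m', n', hc'⟩ := m2
  rw [mul_one, one_mul] at hc hc'
  rw [hc] at h4 h5
  obtain ⟨rfl, rfl⟩ := eq_one_of_norm_lt h4 h5
  have hc1 : c = 1 := by simpa using hc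
  -- The lattice vector `c τ' - τ + 1` is near `1`, so the criterion already used for `c` applies
  -- again.
  have h8 : c * τ' - τ = ((m' + 1 : ℤ) + (n' - 1 : ℤ) * τ : ℂ) - 1 := by
    rw [hc']; push_cast; ring
  rw [h8] at h6 h7
  obtain ⟨h9, h10⟩ := eq_one_of_norm_lt h6 h7
  have : m' = 0 := by omega
  have : n' = 1 := by omega
  subst_vars
  simpa using hc'.symm

namespace Weierstrass

variable (W : Weierstrass)

/-- Substituting `x = 4℘`, `y = 4℘'` and dividing by `16` identifies the invariants as `g₂ = -f/4`
and `g₃ = -g/16`. -/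
lemma uniformizes_iff (z : ℂ) (L : PeriodPair) :
    W.Uniformizes z L ↔ ∀ ζ, ζ ∉ L.lattice → L.derivWeierstrassP ζ ^ 2 =
      4 * L.weierstrassP ζ ^ 3 - (-(W.f.eval z) / 4) * L.weierstrassP ζ - (-(W.g.eval z) / 16) := by
  unfold Uniformizes
  refine forall_congr' fun ζ => imp_congr_right fun _ => ?_
  constructor <;> intro h
  · linear_combination h / 16
  · linear_combination 16 * h

/-- All lattices that uniformize the fibre coincide, so the existential in `periods` can be
evaluated on any one of them. -/
lemma periods_eq_lattice {z : ℂ} {L : PeriodPair} (h₂ : L.g₂ = -(W.f.eval z) / 4)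
    (h₃ : L.g₃ = -(W.g.eval z) / 16) : W.periods z = L.lattice := by
  have hL : W.Uniformizes z L := by
    rw [uniformizes_iff, ← h₂, ← h₃]
    exact L.derivWeierstrassP_sq
  ext γ
  constructor
  · rintro ⟨M, hM, hγ⟩
    rw [uniformizes_iff] at hM hL
    rwa [lattice_eq_of_ode hM hL] at hγ
  · intro hγ
    exact ⟨L, hL, hγ⟩

/-- Near each point of `S` there are cycles whose periods are holomorphic. -/
theorem exists_frame {z₀ : ℂ} (hz₀ : z₀ ∈ W.base) : ∃ F : W.Frame, z₀ ∈ F.V := by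
  set a : ℂ → ℂ := fun z => -(W.f.eval z) / 4
  set b : ℂ → ℂ := fun z => -(W.g.eval z) / 16
  have ha : AnalyticAt ℂ a z₀ := by
    have : Differentiable ℂ a := by fun_prop
    exact this.analyticAt z₀
  have hb : AnalyticAt ℂ b z₀ := by
    have : Differentiable ℂ b := by fun_prop
    exact this.analyticAt z₀
  have hdisc : a z₀ ^ 3 - 27 * b z₀ ^ 2 ≠ 0 := by
    have h : W.disc.eval z₀ ≠ 0 := hz₀
    intro h0
    apply h
    simp only [a, b] at h0
    simp only [disc, eval_add, eval_mul, eval_pow, eval_ofNat]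
    linear_combination -256 * h0
  obtain ⟨μ₀, τ₀, hμ₀, hτ₀, hg₂, hg₃⟩ := exists_periodPair _ _ hdisc
  rw [g₂_periodPair_eq] at hg₂
  rw [g₃_periodPair_eq] at hg₃
  have hP : invG₂ τ₀ = μ₀ ^ 4 * a z₀ := by rw [← hg₂, mul_inv_cancel_left₀ (pow_ne_zero _ hμ₀)]
  have hQ : invG₃ τ₀ = μ₀ ^ 6 * b z₀ := by rw [← hg₃, mul_inv_cancel_left₀ (pow_ne_zero _ hμ₀)]
  obtain ⟨τ, μ, hτ, hμ, hτz, hμz, hsol⟩ : ∃ τ μ : ℂ → ℂ, AnalyticAt ℂ τ z₀ ∧ AnalyticAt ℂ μ z₀ ∧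
      τ z₀ = τ₀ ∧ μ z₀ = μ₀ ∧
      ∀ᶠ z in 𝓝 z₀, invG₂ (τ z) = μ z ^ 4 * a z ∧ invG₃ (τ z) = μ z ^ 6 * b z := by
    -- The invariant whose root is extracted must not vanish. Since the discriminant is nonzero, at
    -- least one of the two qualifies.
    by_cases ha0 : a z₀ = 0
    · have hb0 : b z₀ ≠ 0 := by
        intro h
        simp [ha0, h] at hdisc
      obtain ⟨τ, μ, h1, h2, h3, h4, h5⟩ :=
        exists_analyticAt_solution (k := 6) (l := 4) (by norm_num)
        (analyticAt_invG₃ hτ₀) (analyticAt_invG₂ hτ₀) hb ha hμ₀ hb0 hQ hP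
        ((invariants_rigid hτ₀).mono fun x h h1 h2 => h h2 h1)
      exact ⟨τ, μ, h1, h2, h3, h4, h5.mono fun z h => h.symm⟩
    · exact exists_analyticAt_solution (k := 4) (l := 6) (by norm_num)
        (analyticAt_invG₂ hτ₀) (analyticAt_invG₃ hτ₀) ha hb hμ₀ ha0 hP hQ (invariants_rigid hτ₀)
  have hev : ∀ᶠ z in 𝓝 z₀, (invG₂ (τ z) = μ z ^ 4 * a z ∧ invG₃ (τ z) = μ z ^ 6 * b z) ∧
      AnalyticAt ℂ τ z ∧ AnalyticAt ℂ μ z ∧ μ z ≠ 0 ∧ 0 < (τ z).im ∧ z ∈ W.base := by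
    have hbase : IsOpen W.base :=
      isOpen_ne_fun W.disc.continuous continuous_const
    filter_upwards [hsol, hτ.eventually_analyticAt, hμ.eventually_analyticAt,
      hμ.continuousAt.eventually_ne (by rwa [hμz]),
      ContinuousAt.eventually_lt (g := fun z => (τ z).im) continuousAt_const
        (Complex.continuous_im.continuousAt.comp hτ.continuousAt) (by rwa [hτz]),
      hbase.mem_nhds hz₀] with z h1 h2 h3 h4 h5 h6 using ⟨h1, h2, h3, h4, h5, h6⟩
  obtain ⟨V, hV, hVo, hzV⟩ := eventually_nhds_iff.1 hev
  refine ⟨{ V := V, isOpen := hVo, subset := fun z hz => (hV z hz).2.2.2.2.2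
            period := ![μ, fun z => μ z * τ z], holomorphic := ?_, oriented := ?_,
            isBasis := ?_ }, hzV⟩
  · intro I z hz
    obtain ⟨-, h1, h2, -⟩ := hV z hz
    fin_cases I
    · exact h2.differentiableAt.differentiableWithinAt
    · exact (h2.mul h1).differentiableAt.differentiableWithinAt
  · intro z hz
    obtain ⟨-, -, -, h3, h4, -⟩ := hV z hz
    simpa [h3] using h4
  · intro z hz γ
    obtain ⟨⟨h1, h2⟩, -, -, h3, h4, -⟩ := hV z hz
    rw [W.periods_eq_lattice (L := periodPair h3 h4), SetLike.mem_coe, mem_periodPair_lattice]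
    · rfl
    · rw [g₂_periodPair_eq, h1, inv_mul_cancel_left₀ (pow_ne_zero _ h3)]
    · rw [g₃_periodPair_eq, h2, inv_mul_cancel_left₀ (pow_ne_zero _ h3)]

end Weierstrass


namespace Weierstrass.Frame

variable {W : Weierstrass} (F : W.Frame)

/-! ### Flat fibre coordinates -/

/-- The area of the period parallelogram. -/
noncomputable def area (z : ℂ) : ℝ :=
  (F.period 0 z).re * (F.period 1 z).im - (F.period 0 z).im * (F.period 1 z).re

/-- The real coordinates on the fibre dual to the periods. -/
noncomputable def coord (z : ℂ) : Fin 2 → ℂ →L[ℝ] ℝ :=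
  ![(F.area z)⁻¹ • ((F.period 1 z).im • Complex.reCLM - (F.period 1 z).re • Complex.imCLM),
    (F.area z)⁻¹ • ((F.period 0 z).re • Complex.imCLM - (F.period 0 z).im • Complex.reCLM)]

lemma coord_zero_apply (z w : ℂ) : F.coord z 0 w =
    (F.area z)⁻¹ * ((F.period 1 z).im * w.re - (F.period 1 z).re * w.im) := by
  simp [coord]

lemma coord_one_apply (z w : ℂ) : F.coord z 1 w =
    (F.area z)⁻¹ * ((F.period 0 z).re * w.im - (F.period 0 z).im * w.re) := by
  simp [coord]

variable {F} {z : ℂ}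

lemma period_zero_ne_zero (hz : z ∈ F.V) : F.period 0 z ≠ 0 := by
  intro h
  have := F.oriented z hz
  simp [h] at this

lemma area_eq (hz : z ∈ F.V) : F.area z = Complex.normSq (F.period 0 z) * (F.tau z).im := by
  have h0 := period_zero_ne_zero hz
  have h1 : F.period 1 z = F.tau z * F.period 0 z := by
    rw [tau, div_mul_cancel₀ _ h0]
  rw [area, h1, Complex.normSq_apply]
  simp
  ring

lemma area_pos (hz : z ∈ F.V) : 0 < F.area z := by
  rw [area_eq hz]
  exact mul_pos (Complex.normSq_pos.2 (period_zero_ne_zero hz)) (F.oriented z hz)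

lemma weight_eq (z : ℂ) : F.weight z = 2 * F.area z := by
  simp [weight, pairing, lam, lamBar, area]
  ring

lemma coord_period (hz : z ∈ F.V) (I J : Fin 2) :
    F.coord z I (F.period J z) = if I = J then 1 else 0 := by
  have h := (area_pos hz).ne'
  fin_cases I <;> fin_cases J <;> simp [coord_zero_apply, coord_one_apply]
  · rw [inv_mul_eq_iff_eq_mul₀ h, area]; ring
  · right; ring
  · right; ring
  · rw [inv_mul_eq_iff_eq_mul₀ h, area]; ring

lemma sum_coord_mul_period (hz : z ∈ F.V) (w : ℂ) :
    (F.coord z 0 w : ℂ) * F.period 0 z + (F.coord z 1 w : ℂ) * F.period 1 z = w := by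
  have h := (area_pos hz).ne'
  apply Complex.ext <;> simp [coord_zero_apply, coord_one_apply] <;> field_simp <;>
    rw [area] <;> ring

lemma sum_coord_smul_period (hz : z ∈ F.V) (w : ℂ) :
    ∑ I, F.coord z I w • F.period I z = w := by
  simpa [Fin.sum_univ_two] using sum_coord_mul_period hz w

/-- Real-linear maps on the fibre are determined by their values on the periods. -/
lemma clm_ext {E : Type*} [NormedAddCommGroup E] [NormedSpace ℝ E] (hz : z ∈ F.V)
    {A B : ℂ →L[ℝ] E} (h : ∀ I, A (F.period I z) = B (F.period I z)) : A = B := by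
  ext1 w
  rw [← sum_coord_smul_period hz w, map_sum, map_sum]
  simp only [map_smul, h]

/-- The horizontal lift of `1`: the real-linear map with `period I z ↦ ∂ period I z`. -/
noncomputable def conn (F : W.Frame) (z : ℂ) : ℂ →L[ℝ] ℂ :=
  ∑ I, (F.coord z I).smulRight (deriv (F.period I) z)

lemma conn_apply (z w : ℂ) : F.conn z w =
    (F.coord z 0 w : ℂ) * deriv (F.period 0) z + (F.coord z 1 w : ℂ) * deriv (F.period 1) z := by
  simp [conn]

lemma conn_period (hz : z ∈ F.V) (I : Fin 2) :
    F.conn z (F.period I z) = deriv (F.period I) z := by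
  fin_cases I <;> simp [conn_apply, coord_period hz]

/-- By Cramer's rule with `(λ, λ̄) = -2i · area`, the coefficient of `dz` in the definition is the
real-linear map sending each period to its derivative. -/
lemma thetaW_eq (hz : z ∈ F.V) (w : ℂ) (X : ℂ × ℂ) :
    F.thetaW (z, w) X = X.2 - F.conn z w * X.1 := by
  have h := (area_pos hz).ne'
  have hA : pairing (F.lam z) (F.lamBar z) = -2 * Complex.I * F.area z := by
    apply Complex.ext <;> simp [pairing, lam, lamBar, area] <;> ring
  have hA0 : -2 * Complex.I * (F.area z : ℂ) ≠ 0 := by simp [h]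
  have h0 : (F.coord z 0 w : ℂ) * (-2 * Complex.I * F.area z) =
      w * conj (F.period 1 z) - conj w * F.period 1 z := by
    rw [coord_zero_apply]
    apply Complex.ext
    · simp
    · simp
      field_simp
      ring
  have h1 : (F.coord z 1 w : ℂ) * (-2 * Complex.I * F.area z) =
      conj w * F.period 0 z - w * conj (F.period 0 z) := by
    rw [coord_one_apply]
    apply Complex.ext
    · simp
    · simp
      field_simp
      ring
  simp only [thetaW, conn_apply, hA]
  congr 2
  rw [div_eq_iff hA0]
  simp only [pairing, dLam, lam, lamBar]
  linear_combination -(deriv (F.period 0) z) * h0 - (deriv (F.period 1) z) * h1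

/-- `θ^w` as a real-linear map. -/
noncomputable def theta (F : W.Frame) (p : ℂ × ℂ) : ℂ × ℂ →L[ℝ] ℂ :=
  ContinuousLinearMap.snd ℝ ℂ ℂ -
    (ContinuousLinearMap.mul ℝ ℂ (F.conn p.1 p.2)).comp (ContinuousLinearMap.fst ℝ ℂ ℂ)

lemma theta_apply (p X : ℂ × ℂ) : F.theta p X = X.2 - F.conn p.1 p.2 * X.1 := by
  simp [theta]

lemma thetaW_eq_theta {p : ℂ × ℂ} (hp : p.1 ∈ F.V) : F.thetaW p = F.theta p := by
  ext X
  rw [theta_apply]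
  exact thetaW_eq hp p.2 X

variable (F)

/-- The flat fibre coordinates as functions on `V × ℂ`. -/
noncomputable def flat (I : Fin 2) (p : ℂ × ℂ) : ℝ := F.coord p.1 I p.2

lemma contDiffOn_period (I : Fin 2) : ContDiffOn ℝ ∞ (F.period I) F.V :=
  ((F.holomorphic I).contDiffOn F.isOpen).restrict_scalars ℝ

lemma contDiffOn_area : ContDiffOn ℝ ∞ F.area F.V := by
  have h0 := F.contDiffOn_period 0
  have h1 := F.contDiffOn_period 1
  exact ((Complex.reCLM.contDiff.comp_contDiffOn h0).mul
    (Complex.imCLM.contDiff.comp_contDiffOn h1)).sub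
    ((Complex.imCLM.contDiff.comp_contDiffOn h0).mul (Complex.reCLM.contDiff.comp_contDiffOn h1))

lemma contDiffOn_coord (I : Fin 2) : ContDiffOn ℝ ∞ (fun z => F.coord z I) F.V := by
  have h0 := F.contDiffOn_period 0
  have h1 := F.contDiffOn_period 1
  have hA : ContDiffOn ℝ ∞ (fun z => (F.area z)⁻¹) F.V :=
    F.contDiffOn_area.inv fun z hz => (area_pos hz).ne'
  fin_cases I
  · exact hA.smul (((Complex.imCLM.contDiff.comp_contDiffOn h1).smul contDiffOn_const).sub
      ((Complex.reCLM.contDiff.comp_contDiffOn h1).smul contDiffOn_const))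
  · exact hA.smul (((Complex.reCLM.contDiff.comp_contDiffOn h0).smul contDiffOn_const).sub
      ((Complex.imCLM.contDiff.comp_contDiffOn h0).smul contDiffOn_const))

lemma isOpen_domain : IsOpen (F.V ×ˢ (univ : Set ℂ)) := F.isOpen.prod isOpen_univ

lemma contDiffOn_flat (I : Fin 2) : ContDiffOn ℝ ∞ (F.flat I) (F.V ×ˢ univ) :=
  ((F.contDiffOn_coord I).comp contDiffOn_fst fun _ hp => hp.1).clm_apply contDiffOn_snd

lemma hasDerivAt_period (I : Fin 2) (hz : z ∈ F.V) :
    HasDerivAt (F.period I) (deriv (F.period I) z) z :=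
  ((F.holomorphic I).differentiableAt (F.isOpen.mem_nhds hz)).hasDerivAt

/-- `d x_I` is the `I`-th coordinate of `θ^w`. -/
lemma fderiv_flat {p : ℂ × ℂ} (hp : p.1 ∈ F.V) (I : Fin 2) :
    fderiv ℝ (F.flat I) p = (F.coord p.1 I).comp (F.theta p) := by
  have hmem : F.V ×ˢ (univ : Set ℂ) ∈ 𝓝 p := F.isOpen_domain.mem_nhds ⟨hp, mem_univ _⟩
  have hd (J : Fin 2) : HasFDerivAt (F.flat J) (fderiv ℝ (F.flat J) p) p :=
    (((F.contDiffOn_flat J).contDiffAt hmem).differentiableAt (by simp)).hasFDerivAt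
  have hper (J : Fin 2) : HasFDerivAt (fun q : ℂ × ℂ => F.period J q.1)
      (((ContinuousLinearMap.toSpanSingleton ℂ (deriv (F.period J) p.1)).restrictScalars ℝ).comp
        (ContinuousLinearMap.fst ℝ ℂ ℂ)) p :=
    ((F.hasDerivAt_period J hp).hasFDerivAt.restrictScalars ℝ).comp p hasFDerivAt_fst
  -- Differentiate `ζ = ∑ x_I ∫_I λ`, where `∫_I` runs over the `I`-th cycle: the terms with
  -- derivatives of the periods form the connection term of `θ^w`, leaving `θ^w = ∑ dx_I ∫_I λ`.
  have h1 := ((hd 0).smul (hper 0)).add ((hd 1).smul (hper 1))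
  have h2 : HasFDerivAt (fun q : ℂ × ℂ => q.2) (ContinuousLinearMap.snd ℝ ℂ ℂ) p :=
    hasFDerivAt_snd
  have heq : (fun q : ℂ × ℂ => F.flat 0 q • F.period 0 q.1 + F.flat 1 q • F.period 1 q.1)
      =ᶠ[𝓝 p] fun q => q.2 := by
    filter_upwards [hmem] with q hq
    simpa [flat] using sum_coord_mul_period hq.1 q.2
  have h3 := (h1.congr_of_eventuallyEq heq.symm).unique h2
  refine ContinuousLinearMap.ext fun X => ?_
  have h4 := congrArg (fun L : ℂ × ℂ →L[ℝ] ℂ => L X) h3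
  have h5 : F.theta p X = fderiv ℝ (F.flat 0) p X • F.period 0 p.1 +
      fderiv ℝ (F.flat 1) p X • F.period 1 p.1 := by
    rw [theta_apply, conn_apply]
    simp [flat] at h4 ⊢
    linear_combination -h4
  rw [ContinuousLinearMap.comp_apply, h5, map_add, map_smul, map_smul]
  fin_cases I <;> simp [coord_period hp]

end Weierstrass.Frame

open ContinuousAlternatingMap

/-! ### Exterior calculus -/

section Exterior

variable {E : Type*} [NormedAddCommGroup E] [NormedSpace ℝ E] {n : ℕ}

/-- The wedge product of a linear functional and an `n`-form. -/
noncomputable def wedgeForm (φ : E →L[ℝ] ℝ) (β : E [⋀^Fin n]→L[ℝ] ℝ) :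
    E [⋀^Fin (n + 1)]→L[ℝ] ℝ :=
  alternatizeUncurryFin (φ.smulRight β)

lemma wedgeForm_apply (φ : E →L[ℝ] ℝ) (β : E [⋀^Fin n]→L[ℝ] ℝ) (v : Fin (n + 1) → E) :
    wedgeForm φ β v = ∑ i, (-1) ^ i.val * (φ (v i) * β (i.removeNth v)) := by
  simp [wedgeForm, alternatizeUncurryFin_apply]

lemma wedgeForm_apply_two (φ : E →L[ℝ] ℝ) (β : E [⋀^Fin 1]→L[ℝ] ℝ) (X Y : E) :
    wedgeForm φ β ![X, Y] = φ X * β ![Y] - φ Y * β ![X] := by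
  have h0 : (Fin.removeNth 0 ![X, Y]) = ![Y] := by ext i; fin_cases i; rfl
  have h1 : (Fin.removeNth 1 ![X, Y]) = ![X] := by ext i; fin_cases i; rfl
  rw [wedgeForm_apply, Fin.sum_univ_two, h0, h1]
  simp
  ring

lemma wedgeForm_apply_three (φ : E →L[ℝ] ℝ) (β : E [⋀^Fin 2]→L[ℝ] ℝ) (X Y Z : E) :
    wedgeForm φ β ![X, Y, Z] = φ X * β ![Y, Z] - φ Y * β ![X, Z] + φ Z * β ![X, Y] := by
  have h0 : (Fin.removeNth 0 ![X, Y, Z]) = ![Y, Z] := by ext i; fin_cases i <;> rfl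
  have h1 : (Fin.removeNth 1 ![X, Y, Z]) = ![X, Z] := by ext i; fin_cases i <;> rfl
  have h2 : (Fin.removeNth 2 ![X, Y, Z]) = ![X, Y] := by ext i; fin_cases i <;> rfl
  rw [wedgeForm_apply, Fin.sum_univ_three, h0, h1, h2]
  simp
  ring

lemma wedgeForm_zero (φ : E →L[ℝ] ℝ) : wedgeForm φ (0 : E [⋀^Fin n]→L[ℝ] ℝ) = 0 := by
  ext v
  simp [wedgeForm_apply]

lemma ContDiffOn.wedgeForm {G : Type*} [NormedAddCommGroup G] [NormedSpace ℝ G] {s : Set G}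
    {φ : G → E →L[ℝ] ℝ} {β : G → E [⋀^Fin n]→L[ℝ] ℝ} (hφ : ContDiffOn ℝ ∞ φ s)
    (hβ : ContDiffOn ℝ ∞ β s) : ContDiffOn ℝ ∞ (fun x => wedgeForm (φ x) (β x)) s := by
  have h := ContinuousLinearMap.contDiff (𝕜 := ℝ) (n := ∞) (E := E →L[ℝ] E [⋀^Fin n]→L[ℝ] ℝ)
    (F := E [⋀^Fin (n + 1)]→L[ℝ] ℝ) (alternatizeUncurryFinCLM (n := n) ℝ E ℝ)
  exact h.comp_contDiffOn (hφ.smulRight hβ)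

lemma extDeriv_smul_form {x : E → ℝ} {β : E → E [⋀^Fin n]→L[ℝ] ℝ} {p : E}
    (hx : DifferentiableAt ℝ x p) (hβ : DifferentiableAt ℝ β p) :
    extDeriv (fun q => x q • β q) p = wedgeForm (fderiv ℝ x p) (β p) + x p • extDeriv β p := by
  simp only [extDeriv, wedgeForm]
  rw [fderiv_fun_smul hx hβ, alternatizeUncurryFin_add, alternatizeUncurryFin_smul]
  exact add_comm _ _

lemma differentiableAt_of_contDiffOn {G : Type*} [NormedAddCommGroup G] [NormedSpace ℝ G]
    {f : E → G} {U : Set E} (hU : IsOpen U) (hf : ContDiffOn ℝ ∞ f U) {q : E} (hq : q ∈ U) :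
    DifferentiableAt ℝ f q :=
  (hf.contDiffAt (hU.mem_nhds hq)).differentiableAt (by simp)

lemma contDiffOn_extDeriv {β : E → E [⋀^Fin n]→L[ℝ] ℝ} {U : Set E} (hU : IsOpen U)
    (hβ : ContDiffOn ℝ ∞ β U) : ContDiffOn ℝ ∞ (extDeriv β) U := by
  have h := ContinuousLinearMap.contDiff (𝕜 := ℝ) (n := ∞) (E := E →L[ℝ] E [⋀^Fin n]→L[ℝ] ℝ)
    (F := E [⋀^Fin (n + 1)]→L[ℝ] ℝ) (alternatizeUncurryFinCLM (n := n) ℝ E ℝ)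
  exact h.comp_contDiffOn (hβ.fderiv_of_isOpen hU (by simp))

/-- `d (dx ∧ β) = - dx ∧ dβ`. -/
lemma extDeriv_wedgeForm_fderiv {x : E → ℝ} {β : E → E [⋀^Fin n]→L[ℝ] ℝ} {U : Set E}
    (hU : IsOpen U) (hx : ContDiffOn ℝ ∞ x U) (hβ : ContDiffOn ℝ ∞ β U) {p : E} (hp : p ∈ U) :
    extDeriv (fun q => wedgeForm (fderiv ℝ x q) (β q)) p =
      -wedgeForm (fderiv ℝ x p) (extDeriv β p) := by
  have hd {q : E} (hq : q ∈ U) := hU.mem_nhds hq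
  have hdβ := contDiffOn_extDeriv hU hβ
  have hxβ : ContDiffOn ℝ ∞ (fun q => x q • β q) U := hx.smul hβ
  -- `dx ∧ β = d(xβ) - x dβ`; the rest is the Leibniz rule and `d² = 0`.
  have heq : (fun q => wedgeForm (fderiv ℝ x q) (β q)) =ᶠ[𝓝 p]
      fun q => extDeriv (fun q => x q • β q) q + (-1 : ℝ) • (x q • extDeriv β q) := by
    filter_upwards [hd hp] with q hq
    rw [extDeriv_smul_form (differentiableAt_of_contDiffOn hU hx hq)
      (differentiableAt_of_contDiffOn hU hβ hq)]
    simp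
  have hle : minSmoothness ℝ 2 ≤ (∞ : WithTop ℕ∞) := by
    simp only [minSmoothness_of_isRCLikeNormedField]
    exact WithTop.coe_le_coe.2 (le_top : (2 : ℕ∞) ≤ ⊤)
  have hneg : extDeriv (fun q => (-1 : ℝ) • (x q • extDeriv β q)) p =
      (-1 : ℝ) • extDeriv (fun q => x q • extDeriv β q) p :=
    extDeriv_smul (-1 : ℝ) (fun q => x q • extDeriv β q)
  rw [heq.extDeriv_eq,
    extDeriv_fun_add (differentiableAt_of_contDiffOn hU (contDiffOn_extDeriv hU hxβ) hp)
    (((differentiableAt_of_contDiffOn hU hx hp).fun_smul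
      (differentiableAt_of_contDiffOn hU hdβ hp)).fun_const_smul (-1 : ℝ)),
    extDeriv_extDeriv_apply (hxβ.contDiffAt (hd hp)) hle, hneg,
    extDeriv_smul_form (differentiableAt_of_contDiffOn hU hx hp)
      (differentiableAt_of_contDiffOn hU hdβ hp),
    extDeriv_extDeriv_apply (hβ.contDiffAt (hd hp)) hle]
  simp

end Exterior

/-- The pull-back of a form on the base to `ℂ × ℂ`. -/
noncomputable def pullFst {n : ℕ} (a : ℂ [⋀^Fin n]→L[ℝ] ℝ) : (ℂ × ℂ) [⋀^Fin n]→L[ℝ] ℝ :=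
  a.compContinuousLinearMap (ContinuousLinearMap.fst ℝ ℂ ℂ)

lemma pullFst_apply {n : ℕ} (a : ℂ [⋀^Fin n]→L[ℝ] ℝ) (v : Fin n → ℂ × ℂ) :
    pullFst a v = a fun i => (v i).1 := rfl

lemma contDiffOn_pullFst {n : ℕ} {a : ℂ → ℂ [⋀^Fin n]→L[ℝ] ℝ} {V : Set ℂ}
    (ha : ContDiffOn ℝ ∞ a V) :
    ContDiffOn ℝ ∞ (fun q : ℂ × ℂ => pullFst (a q.1)) (V ×ˢ univ) :=
  (compContinuousLinearMapCLM (ContinuousLinearMap.fst ℝ ℂ ℂ)).contDiff.comp_contDiffOn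
    (ha.comp contDiffOn_fst fun _ hp => hp.1)

lemma extDeriv_pullFst {n : ℕ} {a : ℂ → ℂ [⋀^Fin n]→L[ℝ] ℝ} {p : ℂ × ℂ}
    (ha : DifferentiableAt ℝ a p.1) :
    extDeriv (fun q : ℂ × ℂ => pullFst (a q.1)) p = pullFst (extDeriv a p.1) := by
  have h := extDeriv_pullback (f := (Prod.fst : ℂ × ℂ → ℂ)) (x := p) (r := minSmoothness ℝ 2) ha
    contDiffAt_fst le_rfl
  simp only [fderiv_fst] at h
  exact h

/-! ### Lifts of doublets to two-forms -/

namespace Weierstrass.Frame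

variable {W : Weierstrass} (F : W.Frame)

/-- The two-form `∑ dx_I ∧ a_I`. -/
noncomputable def lift (a : Fin 2 → OneForm) (p : ℂ × ℂ) : TwoForm :=
  ∑ I, wedgeForm (fderiv ℝ (F.flat I) p) (pullFst (a I))

variable {F}

lemma lift_apply (a : Fin 2 → OneForm) {p : ℂ × ℂ} (hp : p.1 ∈ F.V) (X Y : ℂ × ℂ) :
    F.lift a p ![X, Y] = ∑ I, (F.coord p.1 I (F.theta p X) * a I ![Y.1] -
      F.coord p.1 I (F.theta p Y) * a I ![X.1]) := by
  have h (Z : ℂ × ℂ) : (fun i : Fin 1 => (![Z] i).1) = ![Z.1] := by ext i; fin_cases i; rfl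
  simp only [lift, ContinuousAlternatingMap.sum_apply, wedgeForm_apply_two, fderiv_flat F hp,
    pullFst_apply, h, ContinuousLinearMap.comp_apply]

lemma contDiffOn_lift {a : Fin 2 → ℂ → OneForm} (ha : ∀ I, ContDiffOn ℝ ∞ (a I) F.V) :
    ContDiffOn ℝ ∞ (fun p => F.lift (fun I => a I p.1) p) (F.V ×ˢ univ) :=
  ContDiffOn.sum fun I _ => ContDiffOn.wedgeForm
    ((F.contDiffOn_flat I).fderiv_of_isOpen F.isOpen_domain (by simp)) (contDiffOn_pullFst (ha I))

lemma extDeriv_lift {a : Fin 2 → ℂ → OneForm} (ha : ∀ I, ContDiffOn ℝ ∞ (a I) F.V)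
    {p : ℂ × ℂ} (hp : p.1 ∈ F.V) :
    extDeriv (fun q => F.lift (fun I => a I q.1) q) p =
      -∑ I, wedgeForm (fderiv ℝ (F.flat I) p) (pullFst (extDeriv (a I) p.1)) := by
  have hp' : p ∈ F.V ×ˢ (univ : Set ℂ) := ⟨hp, mem_univ _⟩
  have hdiff (I : Fin 2) : DifferentiableAt ℝ
      (fun q => wedgeForm (fderiv ℝ (F.flat I) q) (pullFst (a I q.1))) p :=
    ((ContDiffOn.wedgeForm ((F.contDiffOn_flat I).fderiv_of_isOpen F.isOpen_domain (by simp))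
      (contDiffOn_pullFst (ha I))).contDiffAt (F.isOpen_domain.mem_nhds hp')).differentiableAt
      (by simp)
  have ha' (I : Fin 2) : DifferentiableAt ℝ (a I) p.1 :=
    ((ha I).contDiffAt (F.isOpen.mem_nhds hp)).differentiableAt (by simp)
  simp only [lift, Fin.sum_univ_two]
  rw [extDeriv_fun_add (hdiff 0) (hdiff 1),
    extDeriv_wedgeForm_fderiv F.isOpen_domain (F.contDiffOn_flat 0) (contDiffOn_pullFst (ha 0)) hp',
    extDeriv_wedgeForm_fderiv F.isOpen_domain (F.contDiffOn_flat 1) (contDiffOn_pullFst (ha 1)) hp',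
    extDeriv_pullFst (ha' 0), extDeriv_pullFst (ha' 1), neg_add]

/-- Inserting the vertical vector `∫_J λ` together with two vectors `(v, 0)` isolates one summand,
because `dx_I` takes the value `δ_IJ` on it and pull-backs from the base vanish on it. -/
lemma extDeriv_lift_eq_zero_iff {a : Fin 2 → ℂ → OneForm} (ha : ∀ I, ContDiffOn ℝ ∞ (a I) F.V)
    {p : ℂ × ℂ} (hp : p.1 ∈ F.V) :
    extDeriv (fun q => F.lift (fun I => a I q.1) q) p = 0 ↔ ∀ I, extDeriv (a I) p.1 = 0 := by
  rw [extDeriv_lift ha hp]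
  constructor
  · intro h J
    ext v
    have hv : v = ![v 0, v 1] := by ext i; fin_cases i <;> rfl
    have h1 := congrArg (fun η => η ![((0 : ℂ), F.period J p.1), (v 0, (0 : ℂ)), (v 1, (0 : ℂ))]) h
    have e0 (X Y : ℂ × ℂ) : (fun i : Fin 2 => (![X, Y] i).1) = ![X.1, Y.1] := by
      ext i; fin_cases i <;> rfl
    have z1 (η : ℂ [⋀^Fin 2]→L[ℝ] ℝ) (y : ℂ) : η ![0, y] = 0 := η.map_coord_zero 0 rfl
    simp only [ContinuousAlternatingMap.neg_apply, ContinuousAlternatingMap.sum_apply,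
      wedgeForm_apply_three, pullFst_apply, e0, z1, fderiv_flat F hp,
      ContinuousLinearMap.comp_apply, theta_apply, mul_zero, sub_zero, add_zero,
      coord_period hp] at h1
    rw [hv]
    fin_cases J <;> simpa using h1
  · intro h
    have z2 : pullFst (0 : ℂ [⋀^Fin 2]→L[ℝ] ℝ) = 0 := by ext v; rfl
    simp [h, z2, wedgeForm_zero]

end Weierstrass.Frame


/-! ### Two-forms as bilinear forms -/

namespace TwoForm

variable {E : Type*} [NormedAddCommGroup E] [NormedSpace ℝ E] (η : E [⋀^Fin 2]→L[ℝ] ℝ)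

lemma add_left (X X' Y : E) : η ![X + X', Y] = η ![X, Y] + η ![X', Y] := η.vecCons_add ![Y] X X'

lemma smul_left (c : ℝ) (X Y : E) : η ![c • X, Y] = c * η ![X, Y] := η.vecCons_smul ![Y] c X

lemma self_zero (X : E) : η ![X, X] = 0 :=
  η.map_eq_zero_of_eq ![X, X] (i := 0) (j := 1) rfl (by decide)

lemma swap (X Y : E) : η ![X, Y] = -η ![Y, X] := by
  have h : η ![X + Y, X + Y] = η ![X, X + Y] + η ![Y, X + Y] := add_left η X Y (X + Y)
  have h1 (Z : E) : η ![Z, X + Y] = η ![Z, X] + η ![Z, Y] := by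
    have e (v : E) : Function.update ![Z, X] 1 v = ![Z, v] := by
      ext i
      fin_cases i <;> simp
    rw [← e (X + Y), η.map_update_add, e, e]
  rw [self_zero, h1, h1, self_zero, self_zero] at h
  linarith

lemma add_right (X Y Y' : E) : η ![X, Y + Y'] = η ![X, Y] + η ![X, Y'] := by
  rw [swap, add_left, swap η X Y, swap η X Y', neg_add]

lemma smul_right (c : ℝ) (X Y : E) : η ![X, c • Y] = c * η ![X, Y] := by
  rw [swap, smul_left, swap η X Y, mul_neg]

lemma neg_left (X Y : E) : η ![-X, Y] = -η ![X, Y] := by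
  simpa using smul_left η (-1) X Y

variable {η} in
lemma ext_iff' {η' : E [⋀^Fin 2]→L[ℝ] ℝ} : η = η' ↔ ∀ X Y, η ![X, Y] = η' ![X, Y] := by
  refine ⟨fun h _ _ => by rw [h], fun h => ?_⟩
  ext v
  have hv : v = ![v 0, v 1] := by ext i; fin_cases i <;> rfl
  rw [hv]
  exact h _ _

end TwoForm

/-- Complementary minors of a rotation matrix. -/
lemma rotation_minors {R : Matrix (Fin 4) (Fin 4) ℝ} (h : R * R.transpose = 1) (hd : R.det = 1) :
    (R 0 0 * R 1 2 - R 0 2 * R 1 0 = -(R 2 1 * R 3 3 - R 2 3 * R 3 1)) ∧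
    (R 0 0 * R 1 3 - R 0 3 * R 1 0 = R 2 1 * R 3 2 - R 2 2 * R 3 1) ∧
    (R 0 1 * R 1 2 - R 0 2 * R 1 1 = R 2 0 * R 3 3 - R 2 3 * R 3 0) ∧
    (R 0 1 * R 1 3 - R 0 3 * R 1 1 = -(R 2 0 * R 3 2 - R 2 2 * R 3 0)) := by
  have horth (i j : Fin 4) : R i 0 * R j 0 + R i 1 * R j 1 + R i 2 * R j 2 + R i 3 * R j 3 =
      (1 : Matrix (Fin 4) (Fin 4) ℝ) i j := by
    rw [← h, Matrix.mul_apply, Fin.sum_univ_four]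
    rfl
  -- Multiplying by `R` sends the last two columns, which are rows of `R`, to the standard vectors
  -- `e₂`, `e₃`. As `det R = 1`, the determinant is unchanged; standard basis vectors for `v`, `w`
  -- then give the minors.
  have key (v w : Fin 4 → ℝ) :
      (Matrix.of fun i => ![v i, w i, R 2 i, R 3 i]).det =
      (R.mulVec v) 0 * (R.mulVec w) 1 - (R.mulVec w) 0 * (R.mulVec v) 1 := by
    have hprod : R * (Matrix.of fun i => ![v i, w i, R 2 i, R 3 i]) =
        Matrix.of fun i => ![(R.mulVec v) i, (R.mulVec w) i,
          (1 : Matrix (Fin 4) (Fin 4) ℝ) i 2, (1 : Matrix (Fin 4) (Fin 4) ℝ) i 3] := by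
      ext i j
      fin_cases j <;> simp [Matrix.mul_apply, Matrix.mulVec, dotProduct, Fin.sum_univ_four, ← horth]
    have h1 := congrArg Matrix.det hprod
    rw [Matrix.det_mul, hd, one_mul] at h1
    rw [h1]
    simp [Matrix.det_succ_row_zero, Fin.sum_univ_succ, Fin.succAbove]
    ring
  have h02 := key (Pi.single 0 1) (Pi.single 2 1)
  have h03 := key (Pi.single 0 1) (Pi.single 3 1)
  have h12 := key (Pi.single 1 1) (Pi.single 2 1)
  have h13 := key (Pi.single 1 1) (Pi.single 3 1)
  simp [Matrix.det_succ_row_zero, Fin.sum_univ_succ, Fin.succAbove, Matrix.mulVec_single]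
    at h02 h03 h12 h13
  refine ⟨?_, ?_, ?_, ?_⟩ <;> linarith

namespace Weierstrass.Frame

variable {W : Weierstrass} (F : W.Frame)

/-! ### Mixed two-forms -/

/-- The horizontal lift of a tangent vector of the base. -/
noncomputable def hor (p : ℂ × ℂ) (h : ℂ) : ℂ × ℂ := (h, F.conn p.1 p.2 * h)

/-- A two-form is mixed if it vanishes on pairs of vertical and on pairs of horizontal vectors. -/
def IsMixed (p : ℂ × ℂ) (η : TwoForm) : Prop :=
  (∀ u v : ℂ, η ![(0, u), (0, v)] = 0) ∧ ∀ h k : ℂ, η ![F.hor p h, F.hor p k] = 0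

variable {F} {p : ℂ × ℂ} {η : TwoForm}

lemma theta_hor (h : ℂ) : F.theta p (F.hor p h) = 0 := by simp [theta_apply, hor]

lemma theta_vert (u : ℂ) : F.theta p (0, u) = u := by simp [theta_apply]

lemma theta_smul_I (X : ℂ × ℂ) : F.theta p (Complex.I • X) = Complex.I * F.theta p X := by
  simp [theta_apply]
  ring

lemma hor_add_vert (X : ℂ × ℂ) : F.hor p X.1 + (0, F.theta p X) = X := by
  ext <;> simp [hor, theta_apply]

lemma IsMixed.apply (h : F.IsMixed p η) (X Y : ℂ × ℂ) :
    η ![X, Y] = η ![(0, F.theta p X), F.hor p Y.1] - η ![(0, F.theta p Y), F.hor p X.1] := by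
  conv_lhs => rw [← hor_add_vert (F := F) (p := p) X, ← hor_add_vert (F := F) (p := p) Y]
  rw [TwoForm.add_left, TwoForm.add_right, TwoForm.add_right, h.1, h.2,
    TwoForm.swap η (F.hor p X.1)]
  ring

/-- The value of a two-form on a vertical and a horizontal vector, in real coordinates. -/
lemma apply_vert_hor (F : W.Frame) (p : ℂ × ℂ) (η : TwoForm) (u h : ℂ) :
    η ![(0, u), F.hor p h] =
      η ![(0, 1), F.hor p 1] * (u.re * h.re) + η ![(0, 1), F.hor p Complex.I] * (u.re * h.im) +
      η ![(0, Complex.I), F.hor p 1] * (u.im * h.re) +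
      η ![(0, Complex.I), F.hor p Complex.I] * (u.im * h.im) := by
  have hu : ((0 : ℂ), u) = u.re • ((0 : ℂ), (1 : ℂ)) + u.im • ((0 : ℂ), Complex.I) := by
    ext <;> simp
  have hh : F.hor p h = h.re • F.hor p 1 + h.im • F.hor p Complex.I := by
    have e : (h.re : ℂ) + h.im * Complex.I = h := Complex.re_add_im h
    refine Prod.ext ?_ ?_
    · simp [hor, e]
    · simp only [hor, Prod.snd_add, Prod.smul_mk, Complex.real_smul]
      linear_combination -(F.conn p.1 p.2) * e
  rw [hu, hh]
  simp only [TwoForm.add_left, TwoForm.add_right, TwoForm.smul_left, TwoForm.smul_right]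
  ring

lemma IsMixed.exists_coeff (h : F.IsMixed p η) : ∃ a b c d : ℝ, ∀ X Y : ℂ × ℂ, η ![X, Y] =
    (a * ((F.theta p X).re * Y.1.re) + b * ((F.theta p X).re * Y.1.im) +
      c * ((F.theta p X).im * Y.1.re) + d * ((F.theta p X).im * Y.1.im)) -
    (a * ((F.theta p Y).re * X.1.re) + b * ((F.theta p Y).re * X.1.im) +
      c * ((F.theta p Y).im * X.1.re) + d * ((F.theta p Y).im * X.1.im)) :=
  ⟨_, _, _, _, fun X Y => by
    rw [h.apply, apply_vert_hor F p η (F.theta p X), apply_vert_hor F p η (F.theta p Y)]⟩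

lemma formB_apply (X Y : ℂ × ℂ) : F.formB p X Y =
    (4 * F.area p.1) * Complex.I * ((X.1.im * Y.1.re - X.1.re * Y.1.im : ℝ) : ℂ) := by
  rw [formB, weight_eq]
  apply Complex.ext <;> simp [thetaZZ, wedge₁, thetaZ] <;> (try right) <;> ring

lemma formF_apply (hp : p.1 ∈ F.V) (X Y : ℂ × ℂ) : F.formF p X Y =
    ((F.area p.1)⁻¹ : ℝ) * Complex.I * (((F.theta p X).im * (F.theta p Y).re -
      (F.theta p X).re * (F.theta p Y).im : ℝ) : ℂ) := by
  rw [formF, weight_eq, thetaWW, thetaW_eq_theta hp, ← Complex.ofReal_inv, mul_inv]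
  apply Complex.ext <;> simp [wedge₁] <;> (try right) <;> ring

/-- `Ξ ∧ B = Ξ ∧ F = 0` says that `Ξ` is mixed. -/
lemma isMixed_iff_transverse (hp : p.1 ∈ F.V) : F.IsMixed p η ↔ ∀ X : Fin 4 → ℂ × ℂ,
    wedge₂ (fun Y Z => ((η ![Y, Z] : ℝ) : ℂ)) (F.formB p) X = 0 ∧
    wedge₂ (fun Y Z => ((η ![Y, Z] : ℝ) : ℂ)) (F.formF p) X = 0 := by
  have hA := (area_pos hp).ne'
  constructor
  · intro h X
    obtain ⟨a, b, c, d, hη⟩ := h.exists_coeff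
    simp only [wedge₂, formB_apply, formF_apply hp, hη]
    constructor <;> push_cast <;> ring
  · intro h
    constructor
    · intro u v
      -- `B` vanishes as soon as one argument is vertical, so a single shuffle survives. Below, `F`
      -- vanishes in the same way on horizontal vectors.
      have h1 := (h ![(0, u), (0, v), (1, 0), (Complex.I, 0)]).1
      simpa [wedge₂, formB_apply, hA] using h1
    · intro k l
      have h1 := (h ![F.hor p k, F.hor p l, (0, 1), (0, Complex.I)]).2
      simpa [wedge₂, formF_apply hp, theta_hor, theta_vert, hA] using h1

/-! ### The Hodge star of a mixed form -/

/-- The two-form `-η(iX, iY)`. -/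
noncomputable def iTwist : TwoForm →L[ℝ] TwoForm :=
  -ContinuousAlternatingMap.compContinuousLinearMapCLM
    (ContinuousLinearMap.lsmul ℝ ℂ Complex.I : ℂ × ℂ →L[ℝ] ℂ × ℂ)

lemma iTwist_apply (η : TwoForm) (X Y : ℂ × ℂ) :
    iTwist η ![X, Y] = -η ![Complex.I • X, Complex.I • Y] := by
  have h : (fun i : Fin 2 => Complex.I • ![X, Y] i) = ![Complex.I • X, Complex.I • Y] := by
    ext i <;> fin_cases i <;> rfl
  change -η (fun i : Fin 2 => Complex.I • ![X, Y] i) = _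
  rw [h]

variable {t : ℝ}

lemma metric_apply (hp : p.1 ∈ F.V) (X Y : ℂ × ℂ) : F.metric t p X Y =
    4 * F.area p.1 / t * (X.1.re * Y.1.re + X.1.im * Y.1.im) +
    t / F.area p.1 *
      ((F.theta p X).re * (F.theta p Y).re + (F.theta p X).im * (F.theta p Y).im) := by
  rw [metric, kahler, formB_apply, formF_apply hp, theta_smul_I, ← Complex.ofReal_inv]
  simp
  ring

/-- The coordinates of `X` in an orthonormal coframe. -/
noncomputable def coframe (F : W.Frame) (t : ℝ) (p X : ℂ × ℂ) : Fin 4 → ℝ :=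
  ![√(4 * F.area p.1 / t) * X.1.re, √(4 * F.area p.1 / t) * X.1.im,
    √(t / F.area p.1) * (F.theta p X).re, √(t / F.area p.1) * (F.theta p X).im]

lemma coframe_scale (hp : p.1 ∈ F.V) (ht : 0 < t) :
    √(4 * F.area p.1 / t) * √(t / F.area p.1) = 2 := by
  have hA := area_pos hp
  rw [← Real.sqrt_mul (by positivity), show 4 * F.area p.1 / t * (t / F.area p.1) = 2 ^ 2 by
    field_simp; norm_num]
  exact Real.sqrt_sq (by norm_num)

lemma coframe_matrix {e : Fin 4 → ℂ × ℂ} (hp : p.1 ∈ F.V) (ht : 0 < t)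
    (he : F.IsOrientedOrthonormal t p e) :
    (Matrix.of fun i => F.coframe t p (e i)) * (Matrix.of fun i => F.coframe t p (e i)).transpose
      = 1 ∧ (Matrix.of fun i => F.coframe t p (e i)).det = 1 := by
  have hA := area_pos hp
  have h1 : (Matrix.of fun i => F.coframe t p (e i)) *
      (Matrix.of fun i => F.coframe t p (e i)).transpose = 1 := by
    ext i j
    rw [Matrix.one_apply, ← he.1 i j, metric_apply hp]
    simp only [Matrix.mul_apply, Fin.sum_univ_four, Matrix.transpose_apply, Matrix.of_apply,
      coframe]
    have s1 := Real.mul_self_sqrt (show 0 ≤ 4 * F.area p.1 / t by positivity)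
    have s2 := Real.mul_self_sqrt (show 0 ≤ t / F.area p.1 by positivity)
    rw [← s1, ← s2]
    simp
    ring
  refine ⟨h1, ?_⟩
  have h2 := congrArg Matrix.det h1
  rw [Matrix.det_mul, Matrix.det_transpose, Matrix.det_one] at h2
  set c := F.conn p.1 p.2
  set α := √(4 * F.area p.1 / t) with hα
  set β := √(t / F.area p.1) with hβ
  have h3 : (Matrix.of fun i => F.coframe t p (e i)) =
      (Matrix.of fun i => ![(e i).1.re, (e i).1.im, (e i).2.re, (e i).2.im]) *
      !![α, 0, -β * c.re, -β * c.im; 0, α, β * c.im, -β * c.re; 0, 0, β, 0; 0, 0, 0, β] := by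
    ext i j
    fin_cases j <;> simp [Matrix.mul_apply, Fin.sum_univ_four, coframe, theta_apply,
      ← hα, ← hβ] <;> ring
  have h4 : (!![α, 0, -β * c.re, -β * c.im; 0, α, β * c.im, -β * c.re; 0, 0, β, 0; 0, 0, 0, β] :
      Matrix (Fin 4) (Fin 4) ℝ).det = α ^ 2 * β ^ 2 := by
    simp [Matrix.det_succ_row_zero, Fin.sum_univ_succ, Fin.succAbove]
    ring
  have h5 : 0 < (Matrix.of fun i => F.coframe t p (e i)).det := by
    rw [h3, Matrix.det_mul, h4]
    have : 0 < α := Real.sqrt_pos.2 (by positivity)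
    have : 0 < β := Real.sqrt_pos.2 (by positivity)
    exact mul_pos he.2 (by positivity)
  nlinarith

/-- An oriented orthonormal frame is a rotation matrix in the standard coframe. A mixed form only
involves minors with one base and one fibre index, and complementary ones agree up to sign. All
these minors carry the same factor `αβ = 2`, in which `t` and the area cancel. -/
lemma IsMixed.isHodgeDual (hp : p.1 ∈ F.V) (ht : 0 < t) (h : F.IsMixed p η) :
    F.IsHodgeDual t p η (iTwist η) := by
  intro e he
  obtain ⟨a, b, c, d, hη⟩ := h.exists_coeff
  obtain ⟨hR, hdet⟩ := coframe_matrix hp ht he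
  obtain ⟨m1, m2, m3, m4⟩ := rotation_minors hR hdet
  have hs := coframe_scale hp ht
  simp only [Matrix.of_apply, coframe] at m1 m2 m3 m4
  rw [iTwist_apply, hη, hη]
  simp only [theta_smul_I]
  simp at m1 m2 m3 m4 ⊢
  set α := √(4 * F.area p.1 / t)
  set β := √(t / F.area p.1)
  apply mul_left_cancel₀ (two_ne_zero (α := ℝ))
  rw [← hs]
  linear_combination d * m1 - b * m2 - c * m3 + a * m4

lemma exists_isOrientedOrthonormal (hp : p.1 ∈ F.V) (ht : 0 < t) :
    ∃ e, F.IsOrientedOrthonormal t p e := by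
  have hA := area_pos hp
  set c := (√(4 * F.area p.1 / t))⁻¹ with hc
  set d := (√(t / F.area p.1))⁻¹ with hd
  have hc0 : 0 < c := inv_pos.2 (Real.sqrt_pos.2 (by positivity))
  have hd0 : 0 < d := inv_pos.2 (Real.sqrt_pos.2 (by positivity))
  have hc2 : 4 * F.area p.1 / t * (c * c) = 1 := by
    rw [hc, ← mul_inv, Real.mul_self_sqrt (by positivity)]
    field_simp
  have hd2 : t / F.area p.1 * (d * d) = 1 := by
    rw [hd, ← mul_inv, Real.mul_self_sqrt (by positivity)]
    field_simp
  refine ⟨![F.hor p c, F.hor p (c * Complex.I), (0, d), (0, d * Complex.I)], ?_, ?_⟩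
  · intro i j
    rw [metric_apply hp]
    fin_cases i <;> fin_cases j <;> simp [theta_hor, theta_vert, hd2] <;> simp [hor, hc2]
  · simp [Matrix.det_succ_row_zero, Fin.sum_univ_succ, Fin.succAbove, hor]
    positivity

lemma IsOrientedOrthonormal.comp_perm {e : Fin 4 → ℂ × ℂ} (he : F.IsOrientedOrthonormal t p e)
    {σ : Equiv.Perm (Fin 4)} (hσ : Equiv.Perm.sign σ = 1) :
    F.IsOrientedOrthonormal t p (e ∘ σ) := by
  refine ⟨fun i j => ?_, ?_⟩
  · simp [he.1]
  · have := Matrix.det_permute σ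
      (Matrix.of fun i => ![(e i).1.re, (e i).1.im, (e i).2.re, (e i).2.im])
    rw [hσ] at this
    simp at this
    have h2 := he.2
    rw [← this] at h2
    exact h2

lemma exists_even_perm : ∀ i j : Fin 4, i ≠ j →
    ∃ σ : Equiv.Perm (Fin 4), Equiv.Perm.sign σ = 1 ∧ σ 0 = i ∧ σ 1 = j := by
  decide

/-- The defining condition only tests the first two vectors of an oriented frame; even permutations
of one frame bring every pair to the front. -/
lemma isHodgeDual_unique (hp : p.1 ∈ F.V) (ht : 0 < t) {η₁ η₂ : TwoForm}
    (h₁ : F.IsHodgeDual t p η η₁) (h₂ : F.IsHodgeDual t p η η₂) : η₁ = η₂ := by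
  obtain ⟨e, he⟩ := exists_isOrientedOrthonormal hp ht
  have hli : LinearIndependent ℝ e := by
    rw [Fintype.linearIndependent_iff]
    intro g hg
    have h1 : g = 0 := by
      refine Matrix.eq_zero_of_vecMul_eq_zero he.2.ne' ?_
      have e1 := congrArg Prod.fst hg
      have e2 := congrArg Prod.snd hg
      have r1 := congrArg Complex.re e1
      have i1 := congrArg Complex.im e1
      have r2 := congrArg Complex.re e2
      have i2 := congrArg Complex.im e2
      simp [Fin.sum_univ_four] at r1 i1 r2 i2
      ext j
      fin_cases j <;> simpa [Matrix.vecMul, dotProduct, Fin.sum_univ_four]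
    simp [h1]
  let b := basisOfLinearIndependentOfCardEqFinrank hli (by simp)
  apply ContinuousAlternatingMap.toAlternatingMap_injective
  refine b.ext_alternating fun v hv => ?_
  obtain ⟨σ, hσ, h0, h1⟩ := exists_even_perm (v 0) (v 1) (fun h => by simpa using hv h)
  have hb : (fun i => b (v i)) = ![(e ∘ σ) 0, (e ∘ σ) 1] := by
    ext i <;> fin_cases i <;> simp [b, h0, h1]
  change η₁ (fun i => b (v i)) = η₂ (fun i => b (v i))
  rw [hb, h₁ _ (he.comp_perm hσ), h₂ _ (he.comp_perm hσ)]

end Weierstrass.Frame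

namespace Weierstrass

variable {W : Weierstrass}

lemma mem_frameAt {z : ℂ} (hz : z ∈ W.base) : z ∈ (W.frameAt z).V :=
  Classical.epsilon_spec (W.exists_frame hz)

lemma hodge_eq {t : ℝ} (ht : 0 < t) {p : ℂ × ℂ} (hp : p.1 ∈ W.base) {η : TwoForm}
    (h : (W.frameAt p.1).IsMixed p η) : W.hodge t p η = Frame.iTwist η := by
  have h1 := h.isHodgeDual (mem_frameAt hp) ht
  exact Frame.isHodgeDual_unique (mem_frameAt hp) ht
    (Classical.epsilon_spec (p := (W.frameAt p.1).IsHodgeDual t p η) ⟨_, h1⟩) h1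

end Weierstrass


/-! ### Contraction with vertical vectors -/

lemma oneForm_ext {a b : OneForm} (h : ∀ v, a ![v] = b ![v]) : a = b := by
  ext v
  have hv : v = ![v 0] := by ext i; fin_cases i; rfl
  rw [hv]
  exact h _

/-- The one-form `h ↦ η((0, γ), (h, 0))`, real-linear in `γ` and `η`. -/
noncomputable def contract (η : TwoForm) (γ : ℂ) : OneForm :=
  (η.curryLeft (0, γ)).compContinuousLinearMap (ContinuousLinearMap.inl ℝ ℂ ℂ)

lemma contract_apply (η : TwoForm) (γ h : ℂ) : contract η γ ![h] = η ![(0, γ), (h, 0)] := by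
  change η (Matrix.vecCons (0, γ) fun i => (![h] i, 0)) = _
  congr 1
  ext i <;> fin_cases i <;> rfl

lemma contract_add (η : TwoForm) (γ δ : ℂ) : contract η (γ + δ) = contract η γ + contract η δ := by
  refine oneForm_ext fun v => ?_
  rw [ContinuousAlternatingMap.add_apply]
  simp only [contract_apply]
  rw [← TwoForm.add_left]
  simp

namespace Weierstrass

lemma star_apply (a : OneForm) (h : ℂ) : star a ![h] = -a ![Complex.I * h] := by
  change -a (fun i => Complex.I * ![h] i) = _
  congr 2
  ext i
  fin_cases i
  rfl

end Weierstrass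

namespace Weierstrass.Frame

variable {W : Weierstrass} {F : W.Frame} {p : ℂ × ℂ} {η : TwoForm}

lemma contract_lift (a : Fin 2 → OneForm) (hp : p.1 ∈ F.V) (γ : ℂ) :
    contract (F.lift a p) γ = ∑ I, F.coord p.1 I γ • a I := by
  refine oneForm_ext fun h => ?_
  have h0 (b : OneForm) : b ![0] = 0 := b.map_coord_zero 0 rfl
  simp [contract_apply, lift_apply a hp, h0, theta_vert]

lemma isMixed_lift (a : Fin 2 → OneForm) (hp : p.1 ∈ F.V) : F.IsMixed p (F.lift a p) := by
  have h0 (b : OneForm) : b ![0] = 0 := b.map_coord_zero 0 rfl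
  constructor <;> intro u v <;> simp [lift_apply a hp, theta_hor, h0]

lemma IsMixed.vert_hor (h : F.IsMixed p η) (u k : ℂ) :
    η ![(0, u), F.hor p k] = contract η u ![k] := by
  have : F.hor p k = (k, 0) + (0, F.conn p.1 p.2 * k) := by simp [hor]
  rw [this, TwoForm.add_right, h.1, add_zero, contract_apply]

/-- A mixed form is determined by its contractions with the periods. -/
lemma IsMixed.ext {η' : TwoForm} (hp : p.1 ∈ F.V) (h : F.IsMixed p η) (h' : F.IsMixed p η')
    (hc : ∀ I, contract η (F.period I p.1) = contract η' (F.period I p.1)) : η = η' := by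
  refine TwoForm.ext_iff'.2 fun X Y => ?_
  have key (u : ℂ) : contract η u = contract η' u := by
    refine oneForm_ext fun k => ?_
    have hu : ((0 : ℂ), u) = F.coord p.1 0 u • ((0 : ℂ), F.period 0 p.1) +
        F.coord p.1 1 u • ((0 : ℂ), F.period 1 p.1) := by
      have := sum_coord_mul_period hp u
      ext <;> simp [this]
    have h0 := congrArg (fun b => b ![k]) (hc 0)
    have h1 := congrArg (fun b => b ![k]) (hc 1)
    simp only [contract_apply] at h0 h1
    rw [contract_apply, contract_apply, hu]
    simp only [TwoForm.add_left, TwoForm.smul_left, h0, h1]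
  rw [h.apply, h'.apply, h.vert_hor, h.vert_hor, h'.vert_hor, h'.vert_hor, key, key]

lemma IsMixed.eq_lift (hp : p.1 ∈ F.V) (h : F.IsMixed p η) :
    η = F.lift (fun I => contract η (F.period I p.1)) p := by
  refine h.ext hp (isMixed_lift _ hp) fun I => ?_
  rw [contract_lift _ hp]
  fin_cases I <;> simp [coord_period hp]

/-- This is where `ℳ` enters: it is the complex structure of the fibre in the basis of periods, with
one index turned by the symplectic form. -/
lemma coord_I_mul {z : ℂ} (hz : z ∈ F.V) (u : ℂ) :
    F.coord z 0 (Complex.I * u) =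
      F.coord z 0 u * F.kinetic z 1 0 - F.coord z 1 u * F.kinetic z 0 0 ∧
    F.coord z 1 (Complex.I * u) =
      F.coord z 0 u * F.kinetic z 1 1 - F.coord z 1 u * F.kinetic z 0 1 := by
  have hA := (area_pos hz).ne'
  have h0 := Complex.normSq_pos.2 (period_zero_ne_zero hz)
  have hτ := F.oriented z hz
  have hA2 := area_eq hz
  have h1 : F.period 1 z = F.tau z * F.period 0 z := by
    rw [tau, div_mul_cancel₀ _ (period_zero_ne_zero hz)]
  have hτ' : (F.tau z).im ≠ 0 := hτ.ne'
  simp only [coord_zero_apply, coord_one_apply, kinetic, hA2, h1]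
  rw [Complex.normSq_apply] at h0
  have h0' := h0.ne'
  simp [Complex.normSq_apply]
  constructor <;> field_simp <;> ring

/-- The doublet of one-forms representing the Hodge dual. -/
noncomputable def dual (F : W.Frame) (z : ℂ) (a : Fin 2 → OneForm) : Fin 2 → OneForm :=
  ![star (∑ J, F.kinetic z 1 J • a J), -star (∑ J, F.kinetic z 0 J • a J)]

/-- The twist acts separately on the two factors of `dx_I ∧ a_I`: on the fibre through
`coord_I_mul`, on the base through `star`. -/
lemma iTwist_lift (a : Fin 2 → OneForm) (hp : p.1 ∈ F.V) :
    iTwist (F.lift a p) = F.lift (F.dual p.1 a) p := by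
  refine TwoForm.ext_iff'.2 fun X Y => ?_
  rw [iTwist_apply, lift_apply _ hp, lift_apply _ hp, theta_smul_I, theta_smul_I]
  simp only [Fin.sum_univ_two, (coord_I_mul hp _).1, (coord_I_mul hp _).2, dual,
    Matrix.cons_val_zero, Matrix.cons_val_one, ContinuousAlternatingMap.neg_apply, star_apply,
    ContinuousAlternatingMap.add_apply, ContinuousAlternatingMap.smul_apply, Prod.smul_fst,
    smul_eq_mul]
  ring

/-! ### Change of frame -/

lemma period_mem {z : ℂ} (hz : z ∈ F.V) (I : Fin 2) : F.period I z ∈ W.periods z := by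
  rw [F.isBasis z hz]
  fin_cases I
  · exact ⟨1, 0, by simp⟩
  · exact ⟨0, 1, by simp⟩

/-- A continuous local section of the lattices has constant coordinates. -/
lemma eventually_eq_comb {z : ℂ} (hz : z ∈ F.V) {γ : ℂ → ℂ} (hc : ContinuousAt γ z)
    (hγ : ∀ᶠ y in 𝓝 z, γ y ∈ W.periods y) :
    ∃ m n : ℤ, ∀ᶠ y in 𝓝 z, γ y = m * F.period 0 y + n * F.period 1 y := by
  have hV := F.isOpen.mem_nhds hz
  have hint : ∀ᶠ y in 𝓝 z, ∃ m n : ℤ, γ y = m * F.period 0 y + n * F.period 1 y ∧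
      F.coord y 0 (γ y) = m ∧ F.coord y 1 (γ y) = n := by
    filter_upwards [hγ, hV] with y hy hyV
    obtain ⟨m, n, h⟩ := (F.isBasis y hyV _).1 hy
    have e : γ y = (m : ℝ) • F.period 0 y + (n : ℝ) • F.period 1 y := by simp [h]
    refine ⟨m, n, h, ?_, ?_⟩ <;>
      rw [e, map_add, map_smul, map_smul] <;> simp [coord_period hyV]
  -- The coordinates of `γ` are continuous and integer valued, hence locally constant.
  have hcont (I : Fin 2) : ContinuousAt (fun y => F.coord y I (γ y)) z :=
    (((F.contDiffOn_coord I).continuousOn.continuousAt hV)).clm_apply hc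
  obtain ⟨m, n, hmn, hm, hn⟩ := hint.self_of_nhds
  refine ⟨m, n, ?_⟩
  have h0 := (hcont 0).eventually (Metric.ball_mem_nhds _ one_pos)
  have h1 := (hcont 1).eventually (Metric.ball_mem_nhds _ one_pos)
  filter_upwards [hint, h0, h1] with y ⟨m', n', h', hm', hn'⟩ k0 k1
  rw [hm, hm', Real.dist_eq] at k0
  rw [hn, hn', Real.dist_eq] at k1
  have e0 : m' = m := by
    have : |m' - m| < 1 := by exact_mod_cast k0
    rw [Int.abs_lt_one_iff] at this
    omega
  have e1 : n' = n := by
    have : |n' - n| < 1 := by exact_mod_cast k1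
    rw [Int.abs_lt_one_iff] at this
    omega
  rw [h', e0, e1]

variable {G : W.Frame}

lemma eventually_period_eq {z : ℂ} (hF : z ∈ F.V) (hG : z ∈ G.V) (I : Fin 2) :
    ∃ m n : ℤ, ∀ᶠ y in 𝓝 z, G.period I y = m * F.period 0 y + n * F.period 1 y := by
  refine eventually_eq_comb hF (G.hasDerivAt_period I hG).continuousAt ?_
  filter_upwards [G.isOpen.mem_nhds hG] with y hy using period_mem hy I

/-- Two frames differ by a locally constant integer matrix, so derivatives of periods transform like
periods. Being horizontal or mixed therefore does not depend on the frame. -/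
lemma conn_eq {z : ℂ} (hF : z ∈ F.V) (hG : z ∈ G.V) : F.conn z = G.conn z := by
  refine clm_ext hG fun I => ?_
  obtain ⟨m, n, h⟩ := eventually_period_eq hF hG I
  have hd := (((F.hasDerivAt_period 0 hF).const_mul (m : ℂ)).add
    ((F.hasDerivAt_period 1 hF).const_mul (n : ℂ))).congr_of_eventuallyEq (f₁ := G.period I) h
  rw [conn_period hG, hd.deriv, h.self_of_nhds]
  have e : (m : ℂ) * F.period 0 z + n * F.period 1 z =
    (m : ℝ) • F.period 0 z + (n : ℝ) • F.period 1 z := by simp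
  rw [e, map_add, map_smul, map_smul, conn_period hF, conn_period hF]
  simp

lemma isMixed_iff (hF : p.1 ∈ F.V) (hG : p.1 ∈ G.V) : F.IsMixed p η ↔ G.IsMixed p η := by
  simp [IsMixed, hor, conn_eq hF hG]

lemma additive_comb {z : ℂ} (hz : z ∈ F.V) {A : Type*} [AddCommGroup A] {ξ : ℂ → A}
    (hξ : ∀ γ ∈ W.periods z, ∀ γ' ∈ W.periods z, ξ (γ + γ') = ξ γ + ξ γ') (m n : ℤ) :
    ξ (m * F.period 0 z + n * F.period 1 z) = m • ξ (F.period 0 z) + n • ξ (F.period 1 z) := by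
  let φ : ℤ × ℤ →+ A := AddMonoidHom.mk' (fun k => ξ (k.1 * F.period 0 z + k.2 * F.period 1 z)) (by
    intro a b
    rw [← hξ _ ((F.isBasis z hz _).2 ⟨a.1, a.2, rfl⟩) _ ((F.isBasis z hz _).2 ⟨b.1, b.2, rfl⟩)]
    congr 1
    simp
    ring)
  have h0 : φ (1, 0) = ξ (F.period 0 z) := by simp [φ]
  have h1 : φ (0, 1) = ξ (F.period 1 z) := by simp [φ]
  have h : ((m, n) : ℤ × ℤ) = m • (1, 0) + n • (0, 1) := by simp
  change φ (m, n) = _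
  rw [h, map_add, map_zsmul, map_zsmul, h0, h1]

/-- Under a change of basis the `x_I` transform dually to the components `ξ^I`, so the contraction
over `I` is invariant. -/
lemma lift_eq_lift (hF : p.1 ∈ F.V) (hG : p.1 ∈ G.V) {ξ : ℂ → OneForm}
    (hξ : ∀ γ ∈ W.periods p.1, ∀ γ' ∈ W.periods p.1, ξ (γ + γ') = ξ γ + ξ γ') :
    F.lift (fun I => ξ (F.period I p.1)) p = G.lift (fun I => ξ (G.period I p.1)) p := by
  refine (isMixed_lift _ hF).ext hF ((isMixed_iff hF hG).2 (isMixed_lift _ hG)) fun I => ?_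
  obtain ⟨m, n, h⟩ := (G.isBasis _ hG _).1 (period_mem hF I)
  rw [contract_lift _ hF, contract_lift _ hG]
  have e : F.period I p.1 = (m : ℝ) • G.period 0 p.1 + (n : ℝ) • G.period 1 p.1 := by simp [h]
  have e2 : ∑ J, G.coord p.1 J (F.period I p.1) • ξ (G.period J p.1) = ξ (F.period I p.1) := by
    conv_rhs => rw [h, additive_comb hG hξ, ← Int.cast_smul_eq_zsmul ℝ, ← Int.cast_smul_eq_zsmul ℝ]
    rw [e]
    simp only [map_add, map_smul, Fin.sum_univ_two, coord_period hG]
    simp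
  rw [e2]
  fin_cases I <;> simp [coord_period hF]

end Weierstrass.Frame


/-! ### Cauchy-Riemann equations along the fibres -/

lemma extDeriv_apply_three {E : Type*} [NormedAddCommGroup E] [NormedSpace ℝ E]
    {Ξ : E → E [⋀^Fin 2]→L[ℝ] ℝ} {p : E} (h : DifferentiableAt ℝ Ξ p) (X Y Z : E) :
    extDeriv Ξ p ![X, Y, Z] = fderiv ℝ Ξ p X ![Y, Z] - fderiv ℝ Ξ p Y ![X, Z] +
      fderiv ℝ Ξ p Z ![X, Y] := by
  have h0 : (Fin.removeNth 0 ![X, Y, Z]) = ![Y, Z] := by ext i; fin_cases i <;> rfl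
  have h1 : (Fin.removeNth 1 ![X, Y, Z]) = ![X, Z] := by ext i; fin_cases i <;> rfl
  have h2 : (Fin.removeNth 2 ![X, Y, Z]) = ![X, Y] := by ext i; fin_cases i <;> rfl
  rw [extDeriv_apply h, Fin.sum_univ_three, h0, h1, h2]
  simp only [fderiv_continuousAlternatingMap_apply_const h]
  simp
  ring

lemma contract_smul (η : TwoForm) (c : ℝ) (γ : ℂ) : contract η (c • γ) = c • contract η γ := by
  refine oneForm_ext fun v => ?_
  rw [ContinuousAlternatingMap.smul_apply, contract_apply, contract_apply, smul_eq_mul,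
    ← TwoForm.smul_left]
  simp

lemma ContDiffOn.contract {E : Type*} [NormedAddCommGroup E] [NormedSpace ℝ E] {s : Set E}
    {η : E → TwoForm} {γ : E → ℂ} (hη : ContDiffOn ℝ ∞ η s) (hγ : ContDiffOn ℝ ∞ γ s) :
    ContDiffOn ℝ ∞ (fun x => contract (η x) (γ x)) s := by
  have h1 := ContinuousLinearMap.contDiff (𝕜 := ℝ) (n := ∞) (E := TwoForm)
    (F := ℂ × ℂ →L[ℝ] (ℂ × ℂ) [⋀^Fin 1]→L[ℝ] ℝ)
    (ContinuousAlternatingMap.curryLeftLI.toContinuousLinearMap)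
  have h2 := (h1.comp_contDiffOn hη).clm_apply
    ((contDiffOn_const (c := (0 : ℂ))).prodMk hγ)
  exact (ContinuousAlternatingMap.compContinuousLinearMapCLM
    (ContinuousLinearMap.inl ℝ ℂ ℂ)).contDiff.comp_contDiffOn h2

namespace Weierstrass

variable {W : Weierstrass}

lemma isOpen_base : IsOpen W.base :=
  isOpen_ne_fun W.disc.continuous continuous_const

lemma isOpen_total : IsOpen W.total := isOpen_base.prod isOpen_univ

lemma Frame.fderiv_translate (F : W.Frame) (I : Fin 2) {p : ℂ × ℂ} (hp : p.1 ∈ F.V) (X : ℂ × ℂ) :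
    fderiv ℝ (F.translate I) p X = (X.1, X.2 + X.1 * deriv (F.period I) p.1) := by
  have h1 : HasFDerivAt (fun q : ℂ × ℂ => F.period I q.1)
      (((ContinuousLinearMap.toSpanSingleton ℂ (deriv (F.period I) p.1)).restrictScalars ℝ).comp
        (ContinuousLinearMap.fst ℝ ℂ ℂ)) p :=
    ((F.hasDerivAt_period I hp).hasFDerivAt.restrictScalars ℝ).comp p hasFDerivAt_fst
  have h2 : HasFDerivAt (F.translate I) _ p := HasFDerivAt.prodMk hasFDerivAt_fst
    ((hasFDerivAt_snd (𝕜 := ℝ)).add h1)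
  rw [h2.fderiv]
  simp

section Harmonic

variable {t : ℝ} {Ξ : ℂ × ℂ → TwoForm}

lemma IsTransverse.isMixed (h : W.IsTransverse Ξ) {F : W.Frame} {p : ℂ × ℂ} (hp : p.1 ∈ F.V) :
    F.IsMixed p (Ξ p) := by
  have hb : p.1 ∈ W.base := F.subset hp
  rw [Frame.isMixed_iff hp (mem_frameAt hb), Frame.isMixed_iff_transverse (mem_frameAt hb)]
  exact h p ⟨hb, mem_univ _⟩

lemma IsTransverse.hodge_eq (h : W.IsTransverse Ξ) (ht : 0 < t) {p : ℂ × ℂ} (hp : p ∈ W.total) :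
    W.hodge t p (Ξ p) = Frame.iTwist (Ξ p) :=
  Weierstrass.hodge_eq ht hp.1 (h.isMixed (mem_frameAt hp.1))

lemma IsTransverse.extDeriv_hodge (h : W.IsTransverse Ξ) (ht : 0 < t) {p : ℂ × ℂ}
    (hp : p ∈ W.total) : extDeriv (fun q => W.hodge t q (Ξ q)) p =
      extDeriv (fun q => Frame.iTwist (Ξ q)) p := by
  refine Filter.EventuallyEq.extDeriv_eq ?_
  filter_upwards [isOpen_total.mem_nhds hp] with q hq using h.hodge_eq ht hq

lemma IsTwoForm.differentiableAt (hΞ : W.IsTwoForm Ξ) {p : ℂ × ℂ} (hp : p ∈ W.total) :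
    DifferentiableAt ℝ Ξ p :=
  differentiableAt_of_contDiffOn isOpen_total hΞ.smooth hp

/-- Removes from `dΞ` the term that differentiates the purely vertical component in a base
direction. -/
lemma IsTransverse.fderiv_vert (hT : W.IsTransverse Ξ) (hΞ : W.IsTwoForm Ξ) {p : ℂ × ℂ}
    (hp : p ∈ W.total) (X : ℂ × ℂ) (u v : ℂ) : fderiv ℝ Ξ p X ![(0, u), (0, v)] = 0 := by
  have h1 := fderiv_continuousAlternatingMap_apply_const (hΞ.differentiableAt hp)
    ![((0 : ℂ), u), (0, v)]
  have h2 : (fun q => Ξ q ![((0 : ℂ), u), (0, v)]) =ᶠ[𝓝 p] fun _ => 0 := by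
    filter_upwards [isOpen_total.mem_nhds hp] with q hq
    exact (hT.isMixed (mem_frameAt hq.1)).1 u v
  rw [h2.fderiv_eq] at h1
  simpa using (congrArg (fun L : ℂ × ℂ →L[ℝ] ℝ => L X) h1).symm

/-- A closed and coclosed transverse form restricts to holomorphic data on the fibres. -/
lemma differentiable_fibre (hΞ : W.IsTwoForm Ξ) (hT : W.IsTransverse Ξ)
    (h₁ : ∀ p ∈ W.total, extDeriv Ξ p = 0)
    (h₂ : ∀ p ∈ W.total, extDeriv (fun q => Frame.iTwist (Ξ q)) p = 0) {z : ℂ} (hz : z ∈ W.base)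
    (h : ℂ) : Differentiable ℂ fun ζ : ℂ =>
      ((Ξ (z, ζ) ![(0, 1), (h, 0)] : ℝ) : ℂ) -
        Complex.I * (Ξ (z, ζ) ![(0, Complex.I), (h, 0)] : ℝ) := by
  intro ζ
  have hp : (z, ζ) ∈ W.total := ⟨hz, mem_univ _⟩
  have hd := hΞ.differentiableAt hp
  have hin : HasFDerivAt (fun w : ℂ => (z, w)) (ContinuousLinearMap.inr ℝ ℂ ℂ) ζ :=
    hasFDerivAt_prodMk_right z ζ
  have hA (u : ℂ) : HasFDerivAt (fun w : ℂ => Ξ (z, w) ![(0, u), (h, 0)])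
      (((fderiv ℝ Ξ (z, ζ)).comp (ContinuousLinearMap.inr ℝ ℂ ℂ)).flipAlternating
        ![(0, u), (h, 0)]) ζ :=
    HasFDerivAt.continuousAlternatingMap_apply_const
      (HasFDerivAt.comp (g := Ξ) ζ hd.hasFDerivAt hin) _
  have hC (u : ℂ) := Complex.ofRealCLM.hasFDerivAt.comp ζ (hA u)
  have hk := (hC 1).sub ((hC Complex.I).const_mul Complex.I)
  have hV := hT.fderiv_vert hΞ hp
  have e1 := h₁ _ hp
  have e2 := h₂ _ hp
  have e1' := congrArg (fun η => η ![(0, 1), (0, Complex.I), (h, 0)]) e1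
  -- With `P = Ξ(1, h)` and `Q = Ξ(i, h)`, where `1` and `i` are vertical, closedness gives `∂₂P =
  -- ∂₁Q`. Here `-ih` is inserted because the twist turns it back into `h`; the result is `∂₁P =
  -- -∂₂Q`, so `P - iQ` is holomorphic.
  have e2' := congrArg (fun η => η ![(0, 1), (0, Complex.I), (-Complex.I * h, 0)]) e2
  have hdT : fderiv ℝ (fun q => Frame.iTwist (Ξ q)) (z, ζ) =
      Frame.iTwist.comp (fderiv ℝ Ξ (z, ζ)) :=
    (Frame.iTwist.hasFDerivAt.comp _ hd.hasFDerivAt).fderiv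
  have hdd : DifferentiableAt ℝ (fun q => Frame.iTwist (Ξ q)) (z, ζ) :=
    (Frame.iTwist.hasFDerivAt.comp _ hd.hasFDerivAt).differentiableAt
  simp only [extDeriv_apply_three hd, hV] at e1'
  simp only [extDeriv_apply_three hdd, hdT, ContinuousLinearMap.comp_apply, Frame.iTwist_apply,
    Prod.smul_mk, smul_eq_mul, mul_zero, mul_one, Complex.I_mul_I, hV] at e2'
  have hI : Complex.I * (-Complex.I * h) = h := by
    linear_combination -h * Complex.I_mul_I
  have hneg : ((0 : ℂ), (-1 : ℂ)) = -((0 : ℂ), (1 : ℂ)) := by simp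
  rw [hI, hneg, TwoForm.neg_left] at e2'
  simp at e1' e2'
  refine differentiableAt_complex_iff_differentiableAt_real.2 ⟨hk.differentiableAt, ?_⟩
  have hfd := hk.fderiv
  refine (congrArg (fun L : ℂ →L[ℝ] ℂ => L Complex.I) hfd).trans
    (Eq.trans ?_ (congrArg (fun L : ℂ →L[ℝ] ℂ => Complex.I • L 1) hfd).symm)
  apply Complex.ext <;> simp <;> linarith

end Harmonic

end Weierstrass


/-! ### Liouville's theorem on the fibres -/

namespace Weierstrass

variable {W : Weierstrass} {t : ℝ} {Ξ : ℂ × ℂ → TwoForm}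

/-- An entire function with the periods of a frame is constant. -/
lemma Frame.eq_of_periodic {F : W.Frame} {z : ℂ} (hz : z ∈ F.V) {k : ℂ → ℂ}
    (hk : Differentiable ℂ k) (hper : ∀ I ζ, k (ζ + F.period I z) = k ζ) (ζ ζ' : ℂ) :
    k ζ = k ζ' := by
  refine hk.apply_eq_apply_of_bounded ?_ ζ ζ'
  have hcomp : IsCompact (k '' ((fun s : ℝ × ℝ => (s.1 : ℂ) * F.period 0 z + s.2 * F.period 1 z) ''
      (Icc (0 : ℝ) 1 ×ˢ Icc (0 : ℝ) 1))) :=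
    ((isCompact_Icc.prod isCompact_Icc).image (by fun_prop)).image hk.continuous
  refine hcomp.isBounded.subset ?_
  rintro _ ⟨w, rfl⟩
  have h0 : Function.Periodic k (F.period 0 z) := hper 0
  have h1 : Function.Periodic k (F.period 1 z) := hper 1
  refine ⟨_, ⟨(Int.fract (F.coord z 0 w), Int.fract (F.coord z 1 w)),
    ⟨⟨Int.fract_nonneg _, (Int.fract_lt_one _).le⟩,
      ⟨Int.fract_nonneg _, (Int.fract_lt_one _).le⟩⟩, rfl⟩, ?_⟩
  rw [← h0.sub_int_mul_eq ⌊F.coord z 0 w⌋ (x := w),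
    ← h1.sub_int_mul_eq ⌊F.coord z 1 w⌋ (x := w - ⌊F.coord z 0 w⌋ * F.period 0 z)]
  congr 1
  have hw := Frame.sum_coord_mul_period hz w
  simp only [Int.fract]
  push_cast
  linear_combination hw

/-- The differential of a translation by a period adds a vertical vector to `(h, 0)`, and a mixed
form does not see it against another vertical vector. -/
lemma IsTwoForm.contract_translate (hΞ : W.IsTwoForm Ξ) (hT : W.IsTransverse Ξ) {F : W.Frame}
    {z : ℂ} (hz : z ∈ F.V) (I : Fin 2) (ζ u : ℂ) :
    contract (Ξ (z, ζ + F.period I z)) u = contract (Ξ (z, ζ)) u := by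
  refine oneForm_ext fun h => ?_
  have hm := hT.isMixed (F := F) (p := (z, ζ + F.period I z)) hz
  rw [contract_apply, contract_apply, hΞ.invariant F I (z, ζ) hz]
  have e (X Y : ℂ × ℂ) (η : TwoForm) (L : ℂ × ℂ →L[ℝ] ℂ × ℂ) :
      η.compContinuousLinearMap L ![X, Y] = η ![L X, L Y] := by
    rw [ContinuousAlternatingMap.compContinuousLinearMap_apply]
    congr 1
    ext i <;> fin_cases i <;> rfl
  rw [e, F.fderiv_translate I hz, F.fderiv_translate I hz]
  have hs : ((h, 0 + h * deriv (F.period I) z) : ℂ × ℂ) =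
      (h, 0) + (0, h * deriv (F.period I) z) := by simp
  simp only [zero_mul, add_zero]
  rw [hs, TwoForm.add_right]
  change _ = Ξ (z, ζ + F.period I z) _ + Ξ (z, ζ + F.period I z) _
  rw [hm.1, add_zero]

/-- The contractions of a harmonic form with vertical vectors are constant along the fibres. -/
lemma contract_eq_contract_zero (hΞ : W.IsTwoForm Ξ) (hT : W.IsTransverse Ξ)
    (h₁ : ∀ p ∈ W.total, extDeriv Ξ p = 0)
    (h₂ : ∀ p ∈ W.total, extDeriv (fun q => Frame.iTwist (Ξ q)) p = 0) {z : ℂ} (hz : z ∈ W.base)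
    (ζ u : ℂ) : contract (Ξ (z, ζ)) u = contract (Ξ (z, 0)) u := by
  have hzF := mem_frameAt hz
  have key (h : ℂ) : Ξ (z, ζ) ![(0, 1), (h, 0)] = Ξ (z, 0) ![(0, 1), (h, 0)] ∧
      Ξ (z, ζ) ![(0, Complex.I), (h, 0)] = Ξ (z, 0) ![(0, Complex.I), (h, 0)] := by
    have hk := differentiable_fibre hΞ hT h₁ h₂ hz h
    have h0 := Frame.eq_of_periodic hzF hk (fun I w => by
      simp only [← contract_apply, hΞ.contract_translate hT hzF]) ζ 0
    exact ⟨by simpa using congrArg Complex.re h0, by simpa using congrArg Complex.im h0⟩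
  have hu : u = u.re • (1 : ℂ) + u.im • Complex.I := by
    simp
  rw [hu]
  refine oneForm_ext fun h => ?_
  simp only [contract_add, contract_smul, ContinuousAlternatingMap.add_apply,
    ContinuousAlternatingMap.smul_apply, contract_apply, (key h).1, (key h).2]

/-- Harmonic forms are lifts of their integrals over the cycles of the fibres. -/
lemma eq_lift_of_harmonic (hΞ : W.IsTwoForm Ξ) (hT : W.IsTransverse Ξ)
    (h₁ : ∀ p ∈ W.total, extDeriv Ξ p = 0)
    (h₂ : ∀ p ∈ W.total, extDeriv (fun q => Frame.iTwist (Ξ q)) p = 0) {F : W.Frame} {p : ℂ × ℂ}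
    (hp : p.1 ∈ F.V) : Ξ p = F.lift (fun I => contract (Ξ (p.1, 0)) (F.period I p.1)) p := by
  conv_lhs => rw [(hT.isMixed hp).eq_lift hp]
  congr 1
  ext1 I
  exact contract_eq_contract_zero hΞ hT h₁ h₂ (F.subset hp) p.2 _

lemma cycleIntegral_eq (hc : ∀ z ∈ W.base, ∀ ζ u, contract (Ξ (z, ζ)) u = contract (Ξ (z, 0)) u)
    {z γ : ℂ} (hz : z ∈ W.base) (hγ : γ ∈ W.periods z) :
    W.cycleIntegral Ξ z γ = contract (Ξ (z, 0)) γ := by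
  rw [cycleIntegral, if_pos hγ]
  change ∫ s in (0 : ℝ)..1, contract (Ξ (z, s * γ)) γ = _
  simp [hc z hz]

/-! ### Harmonic equations for lifts -/

namespace Frame

variable {F : W.Frame}

lemma contDiffOn_tau : ContDiffOn ℝ ∞ F.tau F.V :=
  (F.contDiffOn_period 1).mul ((F.contDiffOn_period 0).inv fun _ hz => period_zero_ne_zero hz)

lemma contDiffOn_kinetic (I J : Fin 2) : ContDiffOn ℝ ∞ (fun z => F.kinetic z I J) F.V := by
  have hre := Complex.reCLM.contDiff.comp_contDiffOn (contDiffOn_tau (F := F))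
  have him := Complex.imCLM.contDiff.comp_contDiffOn (contDiffOn_tau (F := F))
  have hinv := him.inv fun z hz => (F.oriented z hz).ne'
  fin_cases I <;> fin_cases J
  · refine (hinv.mul ((hre.mul hre).add (him.mul him))).congr fun z _ => ?_
    simp [kinetic, Complex.normSq_apply]
  · refine (hinv.mul hre.neg).congr fun z _ => ?_
    simp [kinetic]
  · refine (hinv.mul hre.neg).congr fun z _ => ?_
    simp [kinetic]
  · refine hinv.congr fun z _ => ?_
    simp [kinetic]

/-- The Hodge star of one-forms as a continuous linear map. -/
noncomputable def starCLM : OneForm →L[ℝ] OneForm :=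
  -ContinuousAlternatingMap.compContinuousLinearMapCLM (ContinuousLinearMap.mul ℝ ℂ Complex.I)

lemma contDiffOn_star_kinetic {a : Fin 2 → ℂ → OneForm} (ha : ∀ I, ContDiffOn ℝ ∞ (a I) F.V)
    (I : Fin 2) :
    ContDiffOn ℝ ∞ (fun z => star (∑ J, F.kinetic z I J • a J z)) F.V :=
  starCLM.contDiff.comp_contDiffOn
    (ContDiffOn.sum fun J _ => (contDiffOn_kinetic I J).smul (ha J))

/-- A lift is closed and coclosed if and only if the doublet is. -/
lemma lift_harmonic_iff {a : Fin 2 → ℂ → OneForm} (ha : ∀ I, ContDiffOn ℝ ∞ (a I) F.V)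
    {p : ℂ × ℂ} (hp : p.1 ∈ F.V) :
    (extDeriv (fun q => F.lift (fun I => a I q.1) q) p = 0 ∧
      extDeriv (fun q => iTwist (F.lift (fun I => a I q.1) q)) p = 0) ↔
    ∀ I, extDeriv (a I) p.1 = 0 ∧
      extDeriv (fun y => star (∑ J, F.kinetic y I J • a J y)) p.1 = 0 := by
  have hb : ∀ I, ContDiffOn ℝ ∞ (fun z => F.dual z (fun I => a I z) I) F.V := by
    intro I
    fin_cases I
    · exact contDiffOn_star_kinetic ha 1
    · exact (contDiffOn_star_kinetic ha 0).neg
  have heq : (fun q => iTwist (F.lift (fun I => a I q.1) q)) =ᶠ[𝓝 p]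
      fun q => F.lift (fun I => F.dual q.1 (fun I => a I q.1) I) q := by
    filter_upwards [F.isOpen_domain.mem_nhds ⟨hp, mem_univ _⟩] with q hq
    exact iTwist_lift _ hq.1
  have hneg : extDeriv (fun z => F.dual z (fun I => a I z) 1) p.1 =
      -extDeriv (fun y => star (∑ J, F.kinetic y 0 J • a J y)) p.1 := by
    have := extDeriv_smul (𝕜 := ℝ) (x := p.1) (-1 : ℝ)
      (fun y => star (∑ J, F.kinetic y 0 J • a J y))
    rw [neg_one_smul, neg_one_smul] at this
    exact this
  rw [heq.extDeriv_eq, extDeriv_lift_eq_zero_iff ha hp, extDeriv_lift_eq_zero_iff hb hp,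
    Fin.forall_fin_two, Fin.forall_fin_two, Fin.forall_fin_two, hneg, neg_eq_zero]
  -- The dual doublet contains the coclosedness conditions for `I = 1` and then `I = 0`, the latter
  -- with a sign.
  change (_ ∧ extDeriv (fun y => star (∑ J, F.kinetic y 1 J • a J y)) p.1 = 0 ∧ _) ↔ _
  tauto

end Frame

end Weierstrass


lemma twoForm_comp_apply (η : TwoForm) (L : ℂ × ℂ →L[ℝ] ℂ × ℂ) (X Y : ℂ × ℂ) :
    η.compContinuousLinearMap L ![X, Y] = η ![L X, L Y] := by
  rw [ContinuousAlternatingMap.compContinuousLinearMap_apply]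
  congr 1
  ext i <;> fin_cases i <;> rfl

lemma contract_zero (γ : ℂ) : contract 0 γ = 0 := by
  refine oneForm_ext fun h => ?_
  simp [contract_apply]

namespace Weierstrass

namespace Frame

/-- Pull-back of lifts along maps that respect the flat coordinates. -/
lemma lift_eq_pullback {W W' : Weierstrass} {F : W.Frame} {G : W'.Frame} {φ : ℂ × ℂ → ℂ × ℂ}
    {p : ℂ × ℂ} (hp : (φ p).1 ∈ G.V) (hφ : DifferentiableAt ℝ φ p) {c : Fin 2 → ℝ}
    (hflat : ∀ I, (fun q => G.flat I (φ q)) =ᶠ[𝓝 p] fun q => F.flat I q + c I)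
    {a b : Fin 2 → OneForm} (hab : ∀ I X, a I ![X.1] = b I ![(fderiv ℝ φ p X).1]) :
    F.lift a p = (G.lift b (φ p)).compContinuousLinearMap (fderiv ℝ φ p) := by
  have hd (I : Fin 2) (X : ℂ × ℂ) :
      fderiv ℝ (F.flat I) p X = fderiv ℝ (G.flat I) (φ p) (fderiv ℝ φ p X) := by
    have h1 : DifferentiableAt ℝ (G.flat I) (φ p) :=
      differentiableAt_of_contDiffOn G.isOpen_domain (G.contDiffOn_flat I) ⟨hp, mem_univ _⟩
    have h2 := (h1.hasFDerivAt.comp p hφ.hasFDerivAt).congr_of_eventuallyEq (hflat I).symm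
    have h3 : fderiv ℝ (fun q => F.flat I q + c I) p = fderiv ℝ (F.flat I) p := by
      rw [fderiv_add_const]
    rw [← h3, h2.fderiv]
    rfl
  have e (X : ℂ × ℂ) : (fun i : Fin 1 => (![X] i).1) = ![X.1] := by ext i; fin_cases i; rfl
  refine TwoForm.ext_iff'.2 fun X Y => ?_
  rw [twoForm_comp_apply]
  simp only [lift, ContinuousAlternatingMap.sum_apply, wedgeForm_apply_two, pullFst_apply, e, hd,
    hab]

end Frame

variable {W : Weierstrass} {t : ℝ} {Ξ : ℂ × ℂ → TwoForm} {ξ : ℂ → ℂ → OneForm}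

/-! ### From doublets to two-forms -/

open Classical in
/-- The two-form `∑ dx_I ∧ ξ^I`. -/
noncomputable def fromDoublet (W : Weierstrass) (ξ : ℂ → ℂ → OneForm) (p : ℂ × ℂ) : TwoForm :=
  if p.1 ∈ W.base then (W.frameAt p.1).lift (fun I => ξ p.1 ((W.frameAt p.1).period I p.1)) p else 0

lemma fromDoublet_eq (hξ : W.IsDoublet ξ) {F : W.Frame} {p : ℂ × ℂ} (hp : p.1 ∈ F.V) :
    W.fromDoublet ξ p = F.lift (fun I => ξ p.1 (F.period I p.1)) p := by
  have hb := F.subset hp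
  rw [fromDoublet, if_pos hb]
  exact Frame.lift_eq_lift (mem_frameAt hb) hp (hξ.additive _ hb)

lemma fromDoublet_eventuallyEq (hξ : W.IsDoublet ξ) {F : W.Frame} {p : ℂ × ℂ} (hp : p.1 ∈ F.V) :
    W.fromDoublet ξ =ᶠ[𝓝 p] fun q => F.lift (fun I => ξ q.1 (F.period I q.1)) q := by
  filter_upwards [F.isOpen_domain.mem_nhds ⟨hp, mem_univ _⟩] with q hq using fromDoublet_eq hξ hq.1

lemma isTwoForm_fromDoublet (hξ : W.IsDoublet ξ) : W.IsTwoForm (W.fromDoublet ξ) where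
  smooth p hp := by
    have hF := mem_frameAt hp.1
    have h := (Frame.contDiffOn_lift (hξ.smooth (W.frameAt p.1))).contDiffAt
      ((W.frameAt p.1).isOpen_domain.mem_nhds ⟨hF, mem_univ _⟩)
    exact (h.congr_of_eventuallyEq (fromDoublet_eventuallyEq hξ hF)).contDiffWithinAt
  extended p hp := if_neg fun h => hp ⟨h, mem_univ _⟩
  invariant F I p hp := by
    have hp' : (F.translate I p).1 ∈ F.V := hp
    rw [fromDoublet_eq hξ hp, fromDoublet_eq hξ hp']
    -- Translation by the `I`-th period raises `x_I` by `1` and fixes the other flat coordinate.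
    refine Frame.lift_eq_pullback (c := fun J => if J = I then 1 else 0) hp' ?_ (fun J => ?_)
      fun J X => ?_
    · exact DifferentiableAt.prodMk differentiableAt_fst (differentiableAt_snd.add
        (((F.hasDerivAt_period I hp).differentiableAt.restrictScalars ℝ).comp p
          differentiableAt_fst))
    · filter_upwards [F.isOpen_domain.mem_nhds ⟨hp, mem_univ _⟩] with q hq
      simp only [Frame.flat, Frame.translate, map_add, Frame.coord_period hq.1]
    · rw [F.fderiv_translate I hp]
      rfl

lemma isTransverse_fromDoublet (hξ : W.IsDoublet ξ) : W.IsTransverse (W.fromDoublet ξ) := by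
  intro p hp
  have hF := mem_frameAt hp.1
  rw [fromDoublet_eq hξ hF]
  exact (Frame.isMixed_iff_transverse hF).1 (Frame.isMixed_lift _ hF)

lemma isHarmonic_fromDoublet_iff (hξ : W.IsDoublet ξ) (ht : 0 < t) :
    W.IsHarmonicTwoForm t (W.fromDoublet ξ) ↔ W.IsHarmonicDoublet ξ := by
  have hT := isTransverse_fromDoublet hξ
  have key (F : W.Frame) (p : ℂ × ℂ) (hp : p.1 ∈ F.V) :
      (extDeriv (W.fromDoublet ξ) p = 0 ∧
        extDeriv (fun q => W.hodge t q (W.fromDoublet ξ q)) p = 0) ↔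
      ∀ I, extDeriv (fun y => ξ y (F.period I y)) p.1 = 0 ∧
        extDeriv (fun y => star (∑ J, F.kinetic y I J • ξ y (F.period J y))) p.1 = 0 := by
    have heq := fromDoublet_eventuallyEq hξ hp
    have heq' : (fun q => Frame.iTwist (W.fromDoublet ξ q)) =ᶠ[𝓝 p]
        fun q => Frame.iTwist (F.lift (fun I => ξ q.1 (F.period I q.1)) q) :=
      heq.fun_comp Frame.iTwist
    rw [hT.extDeriv_hodge ht ⟨F.subset hp, mem_univ _⟩, ← Frame.lift_harmonic_iff (hξ.smooth F) hp,
      heq.extDeriv_eq, heq'.extDeriv_eq]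
  constructor
  · intro h F I z hz
    exact (key F (z, 0) hz).1 ⟨h.1 _ ⟨F.subset hz, mem_univ _⟩, h.2 _ ⟨F.subset hz, mem_univ _⟩⟩ I
  · intro h
    have h' (p : ℂ × ℂ) (hp : p ∈ W.total) :=
      (key _ p (mem_frameAt hp.1)).2 fun I => h _ I _ (mem_frameAt hp.1)
    exact ⟨fun p hp => (h' p hp).1, fun p hp => (h' p hp).2⟩

lemma contract_fromDoublet (hξ : W.IsDoublet ξ) {z γ : ℂ} (hz : z ∈ W.base)
    (hγ : γ ∈ W.periods z) (ζ : ℂ) : contract (W.fromDoublet ξ (z, ζ)) γ = ξ z γ := by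
  have hF := mem_frameAt hz
  obtain ⟨m, n, h⟩ := ((W.frameAt z).isBasis z hF γ).1 hγ
  rw [fromDoublet_eq hξ (p := (z, ζ)) hF, Frame.contract_lift _ hF]
  conv_rhs => rw [h, Frame.additive_comb hF (hξ.additive z hz), ← Int.cast_smul_eq_zsmul ℝ,
    ← Int.cast_smul_eq_zsmul ℝ]
  have e : γ = (m : ℝ) • (W.frameAt z).period 0 z + (n : ℝ) • (W.frameAt z).period 1 z := by
    simp [h]
  rw [e]
  simp only [map_add, map_smul, Fin.sum_univ_two, Frame.coord_period hF]
  simp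

lemma cycleIntegral_fromDoublet (hξ : W.IsDoublet ξ) :
    W.cycleIntegral (W.fromDoublet ξ) = ξ := by
  ext1 z
  ext1 γ
  -- Outside the base and the periods both sides vanish by the conventions of extension by zero, so
  -- the equality holds for all arguments.
  by_cases h : z ∉ W.base ∨ γ ∉ W.periods z
  · rw [hξ.extended z γ h, cycleIntegral]
    split_ifs with hγ
    · change ∫ s in (0 : ℝ)..1, contract (W.fromDoublet ξ (z, s * γ)) γ = _
      have hz := h.resolve_right (not_not_intro hγ)
      simp [fromDoublet, hz, contract_zero]
    · rfl
  · push Not at h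
    rw [cycleIntegral, if_pos h.2]
    change ∫ s in (0 : ℝ)..1, contract (W.fromDoublet ξ (z, s * γ)) γ = _
    simp [contract_fromDoublet hξ h.1 h.2]

/-! ### From two-forms to doublets -/

lemma IsTwoForm.isDoublet (hΞ : W.IsTwoForm Ξ)
    (hc : ∀ z ∈ W.base, ∀ ζ u, contract (Ξ (z, ζ)) u = contract (Ξ (z, 0)) u) :
    W.IsDoublet (W.cycleIntegral Ξ) where
  additive z hz γ hγ γ' hγ' := by
    have hadd : γ + γ' ∈ W.periods z := by
      have hF := mem_frameAt hz
      obtain ⟨m, n, h⟩ := ((W.frameAt z).isBasis z hF γ).1 hγ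
      obtain ⟨m', n', h'⟩ := ((W.frameAt z).isBasis z hF γ').1 hγ'
      refine ((W.frameAt z).isBasis z hF _).2 ⟨m + m', n + n', ?_⟩
      rw [h, h']
      push_cast
      ring
    rw [cycleIntegral_eq hc hz hγ, cycleIntegral_eq hc hz hγ', cycleIntegral_eq hc hz hadd,
      contract_add]
  smooth F I := by
    have h0 : ContDiffOn ℝ ∞ (fun z : ℂ => Ξ (z, 0)) F.V :=
      hΞ.smooth.comp (contDiff_id.prodMk contDiff_const).contDiffOn
        fun z hz => ⟨F.subset hz, mem_univ _⟩
    exact (ContDiffOn.contract h0 (F.contDiffOn_period I)).congr fun z hz =>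
      cycleIntegral_eq hc (F.subset hz) (Frame.period_mem hz I)
  extended z γ h := by
    rw [cycleIntegral]
    split_ifs with hγ
    · change ∫ s in (0 : ℝ)..1, contract (Ξ (z, s * γ)) γ = _
      have hz := h.resolve_right (not_not_intro hγ)
      have h0 (ζ : ℂ) : Ξ (z, ζ) = 0 := hΞ.extended _ fun h => hz h.1
      simp [h0, contract_zero]
    · rfl

/-- A transverse harmonic form is the two-form of the doublet of its integrals. -/
lemma doublet_of_harmonic (hΞ : W.IsTwoForm Ξ) (hT : W.IsTransverse Ξ) (ht : 0 < t)
    (hH : W.IsHarmonicTwoForm t Ξ) :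
    W.IsDoublet (W.cycleIntegral Ξ) ∧ W.fromDoublet (W.cycleIntegral Ξ) = Ξ := by
  have h₂ : ∀ p ∈ W.total, extDeriv (fun q => Frame.iTwist (Ξ q)) p = 0 := fun p hp => by
    rw [← hT.extDeriv_hodge ht hp]
    exact hH.2 p hp
  have hc : ∀ z ∈ W.base, ∀ ζ u, contract (Ξ (z, ζ)) u = contract (Ξ (z, 0)) u :=
    fun z hz ζ u => contract_eq_contract_zero hΞ hT hH.1 h₂ hz ζ u
  refine ⟨hΞ.isDoublet hc, ?_⟩
  ext1 p
  by_cases hp : p.1 ∈ W.base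
  · have hF := mem_frameAt hp
    rw [fromDoublet, if_pos hp, eq_lift_of_harmonic hΞ hT hH.1 h₂ hF]
    congr 1
    ext1 I
    exact cycleIntegral_eq hc hp (Frame.period_mem hF I)
  · rw [fromDoublet, if_neg hp, hΞ.extended p fun h => hp h.1]

end Weierstrass


namespace Weierstrass

variable {W : Weierstrass} {t : ℝ} {ξ : ℂ → ℂ → OneForm}

/-! ### Norms -/

lemma volume_unit_square : volume (Ico (0 : ℝ) 1 ×ℂ Ico (0 : ℝ) 1) = 1 := by
  have h := Complex.volume_preserving_equiv_real_prod.measure_preimage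
    (s := Ico (0 : ℝ) 1 ×ˢ Ico (0 : ℝ) 1)
    ((measurableSet_Ico.prod measurableSet_Ico).nullMeasurableSet)
  have e : Ico (0 : ℝ) 1 ×ℂ Ico (0 : ℝ) 1 =
      Complex.measurableEquivRealProd ⁻¹' (Ico (0 : ℝ) 1 ×ˢ Ico (0 : ℝ) 1) := by
    ext w
    simp [Complex.mem_reProdIm]
  rw [e, h, Measure.volume_eq_prod, Measure.prod_prod]
  simp

lemma Frame.volume_cell {F : W.Frame} {z : ℂ} (hz : z ∈ F.V) :
    volume (F.cell z) = ENNReal.ofReal (F.area z) := by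
  set L : ℂ →ₗ[ℝ] ℂ := Matrix.toLin Complex.basisOneI Complex.basisOneI
    !![(F.period 0 z).re, (F.period 1 z).re; (F.period 0 z).im, (F.period 1 z).im] with hL
  have hdet : LinearMap.det L = F.area z := by
    rw [hL, LinearMap.det_toLin, Matrix.det_fin_two_of, area]
    ring
  have hLa (s t : ℝ) : L (s + t * Complex.I) = s * F.period 0 z + t * F.period 1 z := by
    rw [hL, Matrix.toLin_apply]
    apply Complex.ext <;> simp [Fin.sum_univ_two, Matrix.mulVec, dotProduct] <;> ring
  have himage : F.cell z = L '' (Ico (0 : ℝ) 1 ×ℂ Ico (0 : ℝ) 1) := by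
    ext ζ
    constructor
    · rintro ⟨s, hs, t, ht, rfl⟩
      exact ⟨s + t * Complex.I, by simp [Complex.mem_reProdIm, hs.1, hs.2, ht.1, ht.2], hLa s t⟩
    · rintro ⟨w, ⟨hs, ht⟩, rfl⟩
      refine ⟨w.re, hs, w.im, ht, ?_⟩
      rw [← hLa, Complex.re_add_im]
  rw [himage, Measure.addHaar_image_linearMap, hdet, volume_unit_square, mul_one,
    abs_of_pos (area_pos hz)]

lemma Frame.kinetic_eq {F : W.Frame} {z : ℂ} (hz : z ∈ F.V) :
    F.kinetic z 0 0 = (F.area z)⁻¹ * Complex.normSq (F.period 1 z) ∧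
    F.kinetic z 0 1 = -((F.area z)⁻¹ * ((F.period 0 z).re * (F.period 1 z).re +
      (F.period 0 z).im * (F.period 1 z).im)) ∧
    F.kinetic z 1 0 = -((F.area z)⁻¹ * ((F.period 0 z).re * (F.period 1 z).re +
      (F.period 0 z).im * (F.period 1 z).im)) ∧
    F.kinetic z 1 1 = (F.area z)⁻¹ * Complex.normSq (F.period 0 z) := by
  have h0 := Complex.normSq_pos.2 (period_zero_ne_zero hz)
  have hτ : (F.tau z).im ≠ 0 := (F.oriented z hz).ne'
  have h1 : F.period 1 z = F.tau z * F.period 0 z := by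
    rw [tau, div_mul_cancel₀ _ (period_zero_ne_zero hz)]
  rw [Complex.normSq_apply] at h0
  have h0' := h0.ne'
  rw [← sq, ← sq] at h0'
  rw [area_eq hz, h1]
  simp only [kinetic, Complex.normSq_apply]
  simp
  refine ⟨?_, ?_, ?_⟩ <;> field_simp <;> ring

/-- The density is that of the doublet times the density of `dx_0 ∧ dx_1` in `ζ`, which is the
inverse area of a period cell. Integration over the cell will cancel this factor. -/
lemma normDensity_eq (ht : 0 < t) (hξ : W.IsDoublet ξ) {p : ℂ × ℂ} (hp : p.1 ∈ W.base) :
    W.normDensity t (W.fromDoublet ξ) p =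
      W.doubletDensity ξ p.1 * ((W.frameAt p.1).area p.1)⁻¹ := by
  have hF := mem_frameAt hp
  have hA := (Frame.area_pos hF).ne'
  obtain ⟨k00, k01, k10, k11⟩ := Frame.kinetic_eq hF
  have h0 (b : OneForm) : b ![0] = 0 := b.map_coord_zero 0 rfl
  have hneg (b : OneForm) : b ![-1] = -b ![1] := by
    simpa using b.vecCons_smul ![] (-1 : ℝ) 1
  have hd := (isTransverse_fromDoublet hξ).hodge_eq ht (p := p) ⟨hp, mem_univ _⟩
  rw [fromDoublet_eq hξ hF, Frame.iTwist_lift _ hF] at hd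
  rw [normDensity, fromDoublet_eq hξ hF, hd, doubletDensity]
  simp only [wedge₂, coordFrame, Frame.dual, Fin.sum_univ_two, k00, k01, k10, k11]
  simp [Frame.lift_apply _ hF, star_apply, h0, hneg, Frame.theta_vert, Frame.coord_zero_apply,
    Frame.coord_one_apply, Complex.normSq_apply]
  rw [Frame.area] at hA ⊢
  field_simp
  ring

lemma isNormalizable_fromDoublet_iff (ht : 0 < t) (hξ : W.IsDoublet ξ) :
    W.IsNormalizableTwoForm t (W.fromDoublet ξ) ↔ W.IsNormalizableDoublet ξ := by
  rw [IsNormalizableTwoForm, IsNormalizableDoublet]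
  have h : ∀ z ∈ W.base, ∫⁻ ζ in (W.frameAt z).cell z,
      ENNReal.ofReal (W.normDensity t (W.fromDoublet ξ) (z, ζ)) =
      ENNReal.ofReal (W.doubletDensity ξ z) := by
    intro z hz
    have hF := mem_frameAt hz
    have hA := Frame.area_pos hF
    simp only [normDensity_eq (p := (z, _)) ht hξ hz, setLIntegral_const, Frame.volume_cell hF]
    rw [← ENNReal.ofReal_mul' hA.le, inv_mul_cancel_right₀ hA.ne']
  rw [setLIntegral_congr_fun isOpen_base.measurableSet h]

end Weierstrass


namespace Weierstrass

variable {W : Weierstrass} {z : ℂ}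

/-! ### The two charts -/

lemma eval_reflect_comp_neg {f : ℂ[X]} {n : ℕ} (hf : f.natDegree ≤ n) (hz : z ≠ 0) :
    ((f.reflect n).comp (-X)).eval (-z⁻¹) * z ^ n = f.eval z := by
  let := invertibleOfNonzero hz
  have h := eval₂_reflect_mul_pow (RingHom.id ℂ) z n f hf
  rw [invOf_eq_inv] at h
  simpa [eval_comp, eval₂_id] using h

lemma eval_disc_atInfinity (hf : W.f.natDegree ≤ 8) (hg : W.g.natDegree ≤ 12) (hz : z ≠ 0) :
    W.atInfinity.disc.eval (-z⁻¹) * z ^ 24 = W.disc.eval z := by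
  simp only [disc, atInfinity, eval_add, eval_mul, eval_pow, eval_ofNat]
  rw [← eval_reflect_comp_neg hf hz, ← eval_reflect_comp_neg hg hz]
  ring

lemma mem_base_atInfinity (hf : W.f.natDegree ≤ 8) (hg : W.g.natDegree ≤ 12) (hz : z ≠ 0) :
    -z⁻¹ ∈ W.atInfinity.base ↔ z ∈ W.base := by
  simp only [base, mem_ofPred_eq, ← eval_disc_atInfinity hf hg hz, ne_eq, mul_eq_zero,
    pow_ne_zero 24 hz, or_false]

/-- Scaling a lattice by `z²` multiplies `g₂` and `g₃` by `z⁻⁸` and `z⁻¹²`, which is how `f` and `g`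
change between the charts. -/
lemma mem_periods_atInfinity (hf : W.f.natDegree ≤ 8) (hg : W.g.natDegree ≤ 12) (hz : z ≠ 0)
    (hb : z ∈ W.base) (γ : ℂ) :
    z ^ 2 * γ ∈ W.atInfinity.periods (-z⁻¹) ↔ γ ∈ W.periods z := by
  have hdisc : (-(W.f.eval z) / 4) ^ 3 - 27 * (-(W.g.eval z) / 16) ^ 2 ≠ 0 := by
    have hb' : W.disc.eval z ≠ 0 := hb
    simp only [disc, eval_add, eval_mul, eval_pow, eval_ofNat] at hb'
    contrapose! hb'
    linear_combination -256 * hb'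
  obtain ⟨μ, τ, hμ, hτ, h₂, h₃⟩ := exists_periodPair _ _ hdisc
  have hμ' : z ^ 2 * μ ≠ 0 := mul_ne_zero (pow_ne_zero 2 hz) hμ
  have h₂' : (periodPair hμ' hτ).g₂ = -(W.atInfinity.f.eval (-z⁻¹)) / 4 := by
    rw [g₂_periodPair_eq] at h₂ ⊢
    rw [← eval_reflect_comp_neg hf hz] at h₂
    change _ = -(((W.f.reflect 8).comp (-X)).eval (-z⁻¹)) / 4
    field_simp at h₂ ⊢
    linear_combination h₂
  have h₃' : (periodPair hμ' hτ).g₃ = -(W.atInfinity.g.eval (-z⁻¹)) / 16 := by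
    rw [g₃_periodPair_eq] at h₃ ⊢
    rw [← eval_reflect_comp_neg hg hz] at h₃
    change _ = -(((W.g.reflect 12).comp (-X)).eval (-z⁻¹)) / 16
    field_simp at h₃ ⊢
    linear_combination h₃
  rw [periods_eq_lattice W h₂ h₃, periods_eq_lattice W.atInfinity h₂' h₃', SetLike.mem_coe,
    SetLike.mem_coe,
    mem_periodPair_lattice, mem_periodPair_lattice]
  refine exists_congr fun m => exists_congr fun n => ?_
  rw [← mul_right_inj' (pow_ne_zero 2 hz) (b := γ)]
  ring_nf

/-- The frame of the chart at infinity given by the same cycles. -/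
noncomputable def Frame.transport (F : W.Frame) (hf : W.f.natDegree ≤ 8)
    (hg : W.g.natDegree ≤ 12) : W.atInfinity.Frame where
  V := {0}ᶜ ∩ (fun w : ℂ => -w⁻¹) ⁻¹' F.V
  isOpen := (continuousOn_inv₀.neg).isOpen_inter_preimage isOpen_compl_singleton F.isOpen
  subset w hw := by
    have h := (mem_base_atInfinity hf hg (neg_ne_zero.2 (inv_ne_zero hw.1))).2 (F.subset hw.2)
    simpa using h
  period I w := (-w⁻¹) ^ 2 * F.period I (-w⁻¹)
  holomorphic I := by
    have h : DifferentiableOn ℂ (fun w : ℂ => -w⁻¹) ({0}ᶜ ∩ (fun w : ℂ => -w⁻¹) ⁻¹' F.V) :=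
      (differentiableOn_inv.mono inter_subset_left).neg
    exact (h.pow 2).mul ((F.holomorphic I).comp h fun w hw => hw.2)
  oriented w hw := by
    have h : (-w⁻¹) ^ 2 ≠ 0 := pow_ne_zero 2 (neg_ne_zero.2 (inv_ne_zero hw.1))
    rw [mul_div_mul_left _ _ h]
    exact F.oriented _ hw.2
  isBasis w hw γ := by
    have hz : -w⁻¹ ≠ 0 := neg_ne_zero.2 (inv_ne_zero hw.1)
    have h := mem_periods_atInfinity hf hg hz (F.subset hw.2) (((-w⁻¹) ^ 2)⁻¹ * γ)
    rw [mul_inv_cancel_left₀ (pow_ne_zero 2 hz), inv_neg, inv_inv, neg_neg] at h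
    rw [h, F.isBasis _ hw.2]
    refine exists_congr fun m => exists_congr fun n => ?_
    rw [inv_mul_eq_iff_eq_mul₀ (pow_ne_zero 2 hz)]
    ring_nf

variable {F : W.Frame} (hf : W.f.natDegree ≤ 8) (hg : W.g.natDegree ≤ 12)

lemma Frame.mem_transport (hz : z ≠ 0) (hF : z ∈ F.V) : -z⁻¹ ∈ (F.transport hf hg).V :=
  ⟨by simpa using hz, by simpa using hF⟩

lemma Frame.transport_period (I : Fin 2) :
    (F.transport hf hg).period I (-z⁻¹) = z ^ 2 * F.period I z := by
  simp [transport]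

/-- Multiplication by `z²` carries each period to the period of the same cycle, so the coordinates
relative to the periods are preserved. -/
lemma Frame.transport_flat {p : ℂ × ℂ} (hz : p.1 ≠ 0) (hF : p.1 ∈ F.V) (I : Fin 2) :
    (F.transport hf hg).flat I (glue p) = F.flat I p := by
  have h : ((F.transport hf hg).coord (-p.1⁻¹) I).comp (ContinuousLinearMap.mul ℝ ℂ (p.1 ^ 2)) =
      F.coord p.1 I := by
    refine clm_ext hF fun J => ?_
    rw [ContinuousLinearMap.comp_apply, ContinuousLinearMap.mul_apply', coord_period hF,
      ← transport_period hf hg, coord_period (mem_transport hf hg hz hF)]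
  exact congrArg (fun L : ℂ →L[ℝ] ℝ => L p.2) h

lemma hasFDerivAt_glue {p : ℂ × ℂ} (hp : p.1 ≠ 0) :
    DifferentiableAt ℝ glue p ∧ ∀ X, fderiv ℝ glue p X =
      (fderiv ℝ (fun y : ℂ => -y⁻¹) p.1 X.1, 2 * p.1 * p.2 * X.1 + p.1 ^ 2 * X.2) := by
  have h1 : HasFDerivAt (fun y : ℂ => -y⁻¹) (fderiv ℝ (fun y : ℂ => -y⁻¹) p.1) p.1 :=
    ((differentiableAt_inv (𝕜 := ℂ) hp).neg.restrictScalars ℝ).hasFDerivAt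
  have h2 : HasFDerivAt (fun q : ℂ × ℂ => q.1 ^ 2 * q.2) _ p :=
    (hasFDerivAt_fst (𝕜 := ℝ).pow 2).mul hasFDerivAt_snd
  have h3 : HasFDerivAt glue _ p := HasFDerivAt.prodMk (h1.comp p hasFDerivAt_fst) h2
  refine ⟨h3.differentiableAt, fun X => ?_⟩
  rw [h3.fderiv]
  ext1
  · rfl
  · simp
    ring

/-- Doublets in the two charts match if and only if their two-forms do. -/
lemma glued_iff (hf : W.f.natDegree ≤ 8) (hg : W.g.natDegree ≤ 12) {ξ ξ' : ℂ → ℂ → OneForm}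
    (hξ : W.IsDoublet ξ) (hξ' : W.atInfinity.IsDoublet ξ') :
    (∀ p : ℂ × ℂ, p.1 ≠ 0 → W.fromDoublet ξ p =
      (W.atInfinity.fromDoublet ξ' (glue p)).compContinuousLinearMap (fderiv ℝ glue p)) ↔
    ∀ z γ : ℂ, z ≠ 0 → ξ z γ =
      (ξ' (-z⁻¹) (z ^ 2 * γ)).compContinuousLinearMap (fderiv ℝ (fun y : ℂ => -y⁻¹) z) := by
  have e (a : OneForm) (L : ℂ →L[ℝ] ℂ) (h : ℂ) :
      a.compContinuousLinearMap L ![h] = a ![L h] := by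
    rw [ContinuousAlternatingMap.compContinuousLinearMap_apply]
    congr 1
    ext i
    fin_cases i
    rfl
  constructor
  · intro h z γ hz
    by_cases hb : z ∈ W.base
    swap
    · rw [hξ.extended z γ (Or.inl hb), hξ'.extended _ _ (Or.inl fun h =>
        hb ((mem_base_atInfinity hf hg hz).1 h))]
      rfl
    by_cases hγ : γ ∈ W.periods z
    swap
    · rw [hξ.extended z γ (Or.inr hγ), hξ'.extended _ _ (Or.inr fun h =>
        hγ ((mem_periods_atInfinity hf hg hz hb γ).1 h))]
      rfl
    -- On the zero section the differential of `glue` has no term `2zζ dz` mixing base and fibre, so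
    -- contraction with a period recovers the gluing rule of doublets.
    rw [← contract_fromDoublet hξ hb hγ 0, ← contract_fromDoublet hξ'
      ((mem_base_atInfinity hf hg hz).2 hb) ((mem_periods_atInfinity hf hg hz hb γ).2 hγ) 0,
      h (z, 0) hz]
    refine oneForm_ext fun k => ?_
    have hfd := (hasFDerivAt_glue (p := (z, 0)) hz).2
    rw [e, contract_apply, contract_apply, twoForm_comp_apply, hfd, hfd]
    simp [glue]
  · intro h p hp
    by_cases hb : p.1 ∈ W.base
    swap
    · have hb' : (glue p).1 ∉ W.atInfinity.base := fun h =>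
        hb ((mem_base_atInfinity hf hg hp).1 h)
      rw [fromDoublet, fromDoublet, if_neg hb, if_neg hb']
      rfl
    have hF := mem_frameAt hb
    have hG := Frame.mem_transport hf hg hp hF
    obtain ⟨hd, hfd⟩ := hasFDerivAt_glue hp
    rw [fromDoublet_eq hξ hF, fromDoublet_eq hξ' (p := glue p) hG]
    refine Frame.lift_eq_pullback (c := 0) hG hd (fun I => ?_) fun I X => ?_
    · filter_upwards [(W.frameAt p.1).isOpen_domain.mem_nhds ⟨hF, mem_univ _⟩,
        (isOpen_ne_fun continuous_fst continuous_const).mem_nhds hp] with q hq hq0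
      rw [Frame.transport_flat hf hg hq0 hq.1]
      simp
    · rw [h p.1 _ hp, e, hfd]
      change _ = ξ' (-p.1⁻¹) (Frame.period _ I (-p.1⁻¹)) _
      rw [Frame.transport_period]

/-- In each chart `fromDoublet` is inverse to `cycleIntegral`, and every condition on one side has
been shown equivalent to its counterpart on the other. -/
theorem bijOn_cycleMap (hW : W.IsGenericK3) {t : ℝ} (ht : 0 < t) :
    BijOn W.cycleMap {Ξ | W.IsSemiFlatHarmonic t Ξ} {ξ | W.IsDoubletHarmonic ξ} := by
  have key : ∀ Ξ, W.IsSemiFlatHarmonic t Ξ → ∀ c, (W.chart c).IsDoublet (W.cycleMap Ξ c) ∧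
      (W.chart c).fromDoublet (W.cycleMap Ξ c) = Ξ c := fun Ξ hΞ c =>
    doublet_of_harmonic (hΞ.isTwoForm c) (hΞ.transverse c) ht (hΞ.harmonic c)
  refine ⟨fun Ξ hΞ => ?_, fun Ξ hΞ Ξ' hΞ' h => ?_, fun ξ hξ => ?_⟩
  · have hk := key Ξ hΞ
    refine ⟨fun c => (hk c).1, ?_, fun c => ?_, ?_⟩
    · refine (glued_iff hW.degree_f hW.degree_g (hk 0).1 (hk 1).1).1 fun p hp => ?_
      have h := hΞ.glued p hp
      rw [← (hk 0).2, ← (hk 1).2] at h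
      exact h
    · rw [← isHarmonic_fromDoublet_iff (hk c).1 ht, (hk c).2]
      exact hΞ.harmonic c
    · refine (isNormalizable_fromDoublet_iff ht (hk 0).1).1 ?_
      have h := hΞ.normalizable
      rw [← (hk 0).2] at h
      exact h
  · ext1 c
    rw [← (key Ξ hΞ c).2, ← (key Ξ' hΞ' c).2, h]
  · refine ⟨fun c => (W.chart c).fromDoublet (ξ c),
      ⟨fun c => isTwoForm_fromDoublet (hξ.isDoublet c),
      (glued_iff hW.degree_f hW.degree_g (hξ.isDoublet 0) (hξ.isDoublet 1)).2 hξ.glued,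
      fun c => (isHarmonic_fromDoublet_iff (hξ.isDoublet c) ht).2 (hξ.harmonic c),
      fun c => isTransverse_fromDoublet (hξ.isDoublet c),
      (isNormalizable_fromDoublet_iff ht (hξ.isDoublet 0)).2 hξ.normalizable⟩, ?_⟩
    ext1 c
    exact cycleIntegral_fromDoublet (hξ.isDoublet c)

end Weierstrass

end EllipticK3

theorem mainTheorem4 (W : EllipticK3.Weierstrass) (hW : W.IsGenericK3) (t : ℝ) (ht : 0 < t) :
    Set.BijOn W.cycleMap {Ξ | W.IsSemiFlatHarmonic t Ξ} {ξ | W.IsDoubletHarmonic ξ} :=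
  EllipticK3.Weierstrass.bijOn_cycleMap hW ht
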